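/- Let $d\in\{2,3\}$ and let $\Omega\subset\mathbb R^d$ be a polygonal ($d=2$) or polyhedral ($d=3$) domain with boundary $\Gamma$, that is, a bounded connected non-empty open set that is the interior of its closure and whose boundary is contained in finitely many hyperplanes. Let $\tau>d/2$ and let $\Phi:\mathbb R^d\to\mathbb R$ be a continuous radial function with Fourier transform satisfying $c_1(1+|\omega|^2)^{-\tau}\le\widehat\Phi(\omega)\le c_2(1+|\omega|^2)^{-\tau}$ for almost all $\omega\in\mathbb R^d$, with constants $c_1,c_2>0$. For $r>0$ put $\Phi_r(x)=r^{-d}\Phi(x/r)$. For a finite non-empty set of centers $X\subset\overline\Omega$ let $h_X=\sup_{x\in\Omega}\min_{y\in X}|x-y|$ and $H_{X,r}=\operatorname{span}\{\Phi_r(\cdot-y): y\in X\}$. Let $\mathcal T_k$ be a partition of $\Gamma$ into finitely many $(d-1)$-dimensional convex polytopes (overlapping at most in sets of zero surface measure), with mesh size $k=\max_{T\in\mathcal T_k}\operatorname{diam}T$. For a fixed integer $p\ge0$ let $\Lambda_k$ be the space of functions on $\Gamma$ that coincide (almost everywhere) on each $T\in\mathcal T_k$ with a polynomial of degree at most $p$.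 With $b(v,\mu)=\int_\Gamma v\mu\,ds$ define $$V_{X,r}=\{v\in H_{X,r}:\ b(v,\mu)=0\ \ \forall\mu\in\Lambda_k\}.$$ Fix $\sigma,\gamma>0$, and consider quasi-uniform $X$ and $\mathcal T_k$, meaning that $h_X\le\sigma|x-y|$ for all distinct $x,y\in X$ and that each $T\in\mathcal T_k$ contains a $(d-1)$-dimensional open disc, centered in $T$ and lying in its affine hull, of radius $k/\gamma$. Then there are constants $k_0>0$ and $C>0$, depending only on $\Omega$, $d$, $\tau$, $\Phi$, $p$, $\sigma$ and $\gamma$, such that for all $r>0$, all such $X$ and all such $\mathcal T_k$ with $k\le k_0$, every $v\in V_{X,r}$ belongs to $H^1(\Omega)$ and satisfies $$\|v\|_{H^1(\Omega)}\le C\,|v|_{H^1(\Omega)},$$ where $|v|_{H^1(\Omega)}^2=\int_\Omega|\nabla v|^2\,dx$ and $\|v\|_{H^1(\Omega)}^2=\int_\Omega v^2\,dx+|v|_{H^1(\Omega)}^2$. In particular, for $\kappa=0$ the bilinear form $a(v,w)=\int_\Omega(\nabla v\cdot\nabla w+\kappa vw)\,dx$ is elliptic on $V_{X,r}$: $\|v\|_{H^1(\Omega)}^2\le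 C^2a(v,v)$ for all $v\in V_{X,r}$. -/

import Mathlib

open MeasureTheory
open scoped FourierTransform ContDiff InnerProductSpace

noncomputable section

namespace RBFMixed

/-- Euclidean `d`-space. -/
abbrev Space (d : ℕ) : Type := EuclideanSpace ℝ (Fin d)

/-! ### Domains -/

/-- A polygonal (`d = 2`) or polyhedral (`d = 3`) domain: a bounded connected nonempty open set,
lying on one side of its boundary (`Ω` is the interior of its closure), whose boundary is contained
in finitely many hyperplanes `⟪n, x⟫ = c`, `n ≠ 0`. -/
structure IsPolyhedralDomain {d : ℕ} (Ω : Set (Space d)) : Prop where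
  isOpen : IsOpen Ω
  isConnected : IsConnected Ω
  isBounded : Bornology.IsBounded Ω
  regular : interior (closure Ω) = Ω
  flat_boundary : ∃ F : Finset (Space d × ℝ), (∀ q ∈ F, q.1 ≠ 0) ∧
    ∀ x ∈ frontier Ω, ∃ q ∈ F, ⟪q.1, x⟫_ℝ = q.2

/-! ### The Sobolev space `H¹(Ω)` -/

/-- `g` is a square integrable weak (distributional) gradient of `v` on `Ω`:
`∫_Ω v ∂ₑφ = - ∫_Ω (g · e) φ` for all directions `e` and all `φ ∈ C_c^∞(Ω)`. -/
def IsWeakGradient {d : ℕ} (Ω : Set (Space d)) (v : Space d → ℝ) (g : Space d → Space d) : Prop :=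
  MemLp g 2 (volume.restrict Ω) ∧
    ∀ φ : Space d → ℝ, ContDiff ℝ ∞ φ → HasCompactSupport φ → tsupport φ ⊆ Ω →
      ∀ e : Space d, ∫ x in Ω, v x * fderiv ℝ φ x e = - ∫ x in Ω, ⟪g x, e⟫_ℝ * φ x

/-- Membership in `H¹(Ω)`. -/
def MemH1 {d : ℕ} (Ω : Set (Space d)) (v : Space d → ℝ) : Prop :=
  MemLp v 2 (volume.restrict Ω) ∧ ∃ g, IsWeakGradient Ω v g

open Classical in
/-- The weak gradient of `v` on `Ω` (unique up to null sets for `v ∈ H¹(Ω)`; `0` if there is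
none). -/
def weakGradient {d : ℕ} (Ω : Set (Space d)) (v : Space d → ℝ) : Space d → Space d :=
  if h : ∃ g, IsWeakGradient Ω v g then h.choose else 0

/-- The seminorm `|v|_{H¹(Ω)} = ‖∇v‖_{L₂(Ω)}`. -/
def h1Seminorm {d : ℕ} (Ω : Set (Space d)) (v : Space d → ℝ) : ℝ :=
  √(∫ x in Ω, ‖weakGradient Ω v x‖ ^ 2)

/-- The norm `‖v‖_{H¹(Ω)} = (‖v‖²_{L₂(Ω)} + ‖∇v‖²_{L₂(Ω)})^{1/2}`. -/
def h1Norm {d : ℕ} (Ω : Set (Space d)) (v : Space d → ℝ) : ℝ :=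
  √((∫ x in Ω, v x ^ 2) + ∫ x in Ω, ‖weakGradient Ω v x‖ ^ 2)

/-- The bilinear form `a(v, w) = ∫_Ω (∇v · ∇w + κ v w) dx`. -/
def formA {d : ℕ} (Ω : Set (Space d)) (κ : ℝ) (v w : Space d → ℝ) : ℝ :=
  ∫ x in Ω, (⟪weakGradient Ω v x, weakGradient Ω w x⟫_ℝ + κ * (v x * w x))

/-- Surface measure `ds` on the boundary `Γ` of `Ω`: `(d-1)`-dimensional
Hausdorff measure normalized to agree with Lebesgue measure on hyperplanes. -/
def surfaceMeasure {d : ℕ} (Ω : Set (Space d)) : Measure (Space d) :=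
  (μHE[d - 1] : Measure (Space d)).restrict (frontier Ω)

/-- The bilinear form `b(v, μ) = ∫_Γ v μ ds`. It is only used for functions `v` that are
continuous on the whole space, whose trace on `Γ` is the pointwise restriction. -/
def formB {d : ℕ} (Ω : Set (Space d)) (v μ : Space d → ℝ) : ℝ :=
  ∫ x, v x * μ x ∂(surfaceMeasure Ω)

/-! ### Scaled radial basis functions -/

/-- `Φ` is a (continuous) radial basis function on `ℝ^d` whose Fourier transform is a real function
satisfying `c (1 + |ξ|²)^{-τ} ≤ Φ̂(ξ) ≤ C (1 + |ξ|²)^{-τ}` for some constants `c, C > 0`.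
For `τ > d/2`, a function with such a Fourier transform is square integrable, so the Fourier
transform is the one on `L₂(ℝ^d)`. -/
structure IsRadialBasisFunction {d : ℕ} (τ : ℝ) (Φ : Space d → ℝ) : Prop where
  radial : ∃ ϕ : ℝ → ℝ, ∀ x, Φ x = ϕ ‖x‖
  continuous : Continuous Φ
  fourier : ∃ h : MemLp (fun x => (Φ x : ℂ)) 2 (volume : Measure (Space d)),
    ∃ (g : Space d → ℝ) (c C : ℝ), 0 < c ∧ 0 < C ∧
      (∀ᵐ ξ : Space d, (𝓕 (h.toLp (fun x => (Φ x : ℂ)))) ξ = (g ξ : ℂ)) ∧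
      ∀ᵐ ξ : Space d, c * (1 + ‖ξ‖ ^ 2) ^ (-τ) ≤ g ξ ∧ g ξ ≤ C * (1 + ‖ξ‖ ^ 2) ^ (-τ)

/-- The scaled radial basis function `Φ_r(x) = r^{-d} Φ(x / r)`. -/
def scaledRBF {d : ℕ} (Φ : Space d → ℝ) (r : ℝ) : Space d → ℝ :=
  fun x => (r ^ d)⁻¹ * Φ (r⁻¹ • x)

/-- The mesh norm `h_X = sup_{x ∈ Ω} min_{y ∈ X} |x - y|`. -/
def meshNorm {d : ℕ} (Ω : Set (Space d)) (X : Finset (Space d)) : ℝ :=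
  ⨆ x : Ω, Metric.infDist (x : Space d) (X : Set (Space d))

/-- `X` is a nonempty finite set of centers in `Ω` or on its boundary which is quasi-uniform with
constant `σ`: the mesh norm is at most `σ` times the distance of any two different centers. -/
structure IsQuasiUniformCenters {d : ℕ} (Ω : Set (Space d)) (σ : ℝ) (X : Finset (Space d)) :
    Prop where
  nonempty : X.Nonempty
  subset : (X : Set (Space d)) ⊆ closure Ω
  quasiUniform : ∀ x ∈ X, ∀ y ∈ X, x ≠ y → meshNorm Ω X ≤ σ * dist x y

/-- The space `H_{X,r}` spanned by the translates `Φ_r(· - y)`, `y ∈ X`. -/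
def rbfSpace {d : ℕ} (Φ : Space d → ℝ) (r : ℝ) (X : Finset (Space d)) :
    Submodule ℝ (Space d → ℝ) :=
  Submodule.span ℝ ((fun y : Space d => fun x : Space d => scaledRBF Φ r (x - y)) '' X)

/-! ### Boundary partitions and multipliers -/

/-- The mesh size `k`: the largest diameter of an element. -/
def meshSize {d : ℕ} (𝒯 : Finset (Set (Space d))) : ℝ :=
  sSup (Metric.diam '' (𝒯 : Set (Set (Space d))))

/-- `𝒯` is a quasi-uniform partition of the boundary `Γ` with constant `γ`: finitely many
`(d-1)`-dimensional convex polytopes (segments for `d = 2`, planar convex polygons for `d = 3`)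
with union `Γ`, not overlapping except in sets of zero surface measure, each containing a
`(d-1)`-dimensional disc of radius `k / γ`, where `k` is the mesh size. -/
structure IsQuasiUniformPartition {d : ℕ} (Γ : Set (Space d)) (γ : ℝ)
    (𝒯 : Finset (Set (Space d))) : Prop where
  polytope : ∀ T ∈ 𝒯, ∃ V : Finset (Space d), T = convexHull ℝ (V : Set (Space d))
  dimension : ∀ T ∈ 𝒯, Module.finrank ℝ (vectorSpan ℝ T) = d - 1
  cover : ⋃ T ∈ 𝒯, T = Γ
  overlap : ∀ T ∈ 𝒯, ∀ T' ∈ 𝒯, T ≠ T' → (μHE[d - 1] : Measure (Space d)) (T ∩ T') = 0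
  inradius : ∀ T ∈ 𝒯, ∃ x ∈ T,
    Metric.ball x (meshSize 𝒯 / γ) ∩ (affineSpan ℝ T : Set (Space d)) ⊆ T

/-- The multiplier space `Λ_k` of (possibly discontinuous) piecewise polynomials of degree at most
`p` on the partition `𝒯`. On an element the polynomial is attained up to a set of zero surface
measure, so that values on the interfaces are irrelevant. -/
def multiplierSpace {d : ℕ} (p : ℕ) (𝒯 : Finset (Set (Space d))) : Set (Space d → ℝ) :=
  {μ | ∀ T ∈ 𝒯, ∃ P : MvPolynomial (Fin d) ℝ, P.totalDegree ≤ p ∧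
    ∀ᵐ x ∂((μHE[d - 1] : Measure (Space d)).restrict T), μ x = MvPolynomial.eval (fun i => x i) P}

/-- The discretely constrained space
`V_{X,r} = {v ∈ H_{X,r} : b(v, μ) = 0 for all μ ∈ Λ_k}`. -/
def constrainedSpace {d : ℕ} (Ω : Set (Space d)) (Φ : Space d → ℝ) (r : ℝ)
    (X : Finset (Space d)) (p : ℕ) (𝒯 : Finset (Set (Space d))) : Set (Space d → ℝ) :=
  {v | v ∈ rbfSpace Φ r X ∧ ∀ μ ∈ multiplierSpace p 𝒯, formB Ω v μ = 0}

end RBFMixed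

end

open RBFMixed

namespace RBFMixed

open Filter Topology
open scoped ENNReal NNReal SchwartzMap LineDeriv

/-! ### A Poincaré relation between measures -/

/-! Constants are polynomials of degree 0, so `Λ_k` contains 1 for every mesh and every `p`. Hence
each `v` in the constrained space has mean zero on `Γ`, and the claim reduces to a Poincaré
inequality for functions of vanishing boundary mean, with a constant depending on `Ω` alone.

That inequality follows from `PoincareRel`, a bound on the mean square oscillation between two
measures, here surface measure and volume. The basic case is `PoincareRel.of_segments`: if almost
all segments from the support of `μ` to `B` run inside `Ω` and `μ` has at least `(d-1)`-dimensional
growth, integrating the gradient along them gives the bound. The relation is symmetric, and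
transitive through a nonzero finite measure, so local bounds can be chained. The hyperplanes
carrying `Γ` cut `Ω` into finitely many convex cells; each cell sees its own closure, including its
share of `Γ`, along segments, and chains of balls join the cells (`PoincareRel.ball_ball`). No
Lipschitz property of the boundary is needed. The result is `IsPolyhedralDomain.poincareRel`;
`surfaceMeasure_ne_zero` then permits division by the mass of `Γ`.

The functions `v` need not be `C¹`. Since `Φ` lies in the Sobolev space of order `τ > d/2 ≥ 1`,
Bessel potentials of Schwartz functions approximate it uniformly and in `H¹`
(`exists_schwartz_approximation`). This property (`IsH1Limit`) passes to the span of scaled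
translates; it identifies the weak gradient and carries the Poincaré bound to the limit by Fatou's
lemma. -/

theorem sq_lintegral_le {α : Type*} [MeasurableSpace α] (μ : Measure α) {f : α → ℝ≥0∞}
    (hf : AEMeasurable f μ) : (∫⁻ x, f x ∂μ) ^ 2 ≤ μ Set.univ * ∫⁻ x, f x ^ 2 ∂μ := by
  have h := ENNReal.lintegral_mul_le_Lp_mul_Lq μ Real.HolderConjugate.two_two hf
    (g := fun _ => 1) aemeasurable_const
  simp only [Pi.mul_apply, mul_one, ENNReal.one_rpow, lintegral_const, one_mul] at h
  have h2 := pow_le_pow_left' h 2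
  refine h2.trans (le_of_eq ?_)
  rw [mul_pow, ← ENNReal.rpow_natCast, ← ENNReal.rpow_natCast, ← ENNReal.rpow_mul,
    ← ENNReal.rpow_mul]
  norm_num
  rw [mul_comm]

/-- Jensen's inequality along the path `s ↦ x + s² (y - x)`. -/
theorem enorm_sub_sq_le_lintegral_path {d : ℕ} {w : Space d → ℝ} (hw : ContDiff ℝ 1 w)
    (x y : Space d) :
    ‖w x - w y‖ₑ ^ 2 ≤ ∫⁻ s in Set.Ioc (0 : ℝ) 1,
      4 * ‖y - x‖ₑ ^ 2 * (ENNReal.ofReal (s ^ 2) *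
        ‖fderiv ℝ w ((1 - s ^ 2) • x + s ^ 2 • y)‖ₑ ^ 2) := by
  -- The quadratic parametrization puts a factor `4 s²` into the squared derivative. With `t = s²`
  -- it cancels the `1 / t` singularity of the density in `lintegral_segment_le`.
  set γ : ℝ → Space d := fun s => (1 - s ^ 2) • x + s ^ 2 • y with hγ
  have hγd : ∀ s, HasDerivAt γ ((2 * s) • (y - x)) s := by
    intro s
    have h1 : HasDerivAt (fun s : ℝ => s ^ 2) (2 * s) s := by simpa using hasDerivAt_pow 2 s
    have h2 := ((h1.const_sub 1).smul_const x).add (h1.smul_const y)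
    convert! h2 using 1
    module
  have hd : ∀ s, HasDerivAt (fun s => w (γ s)) (fderiv ℝ w (γ s) ((2 * s) • (y - x))) s :=
    fun s => ((hw.differentiable (by norm_num)) (γ s)).hasFDerivAt.comp_hasDerivAt s (hγd s)
  have hγc : ContDiff ℝ 1 γ := by fun_prop
  have h := enorm_sub_le_lintegral_deriv_of_contDiffOn_Icc (f := fun s => w (γ s)) (a := 0) (b := 1)
    (hw.comp hγc).contDiffOn zero_le_one
  have e0 : γ 0 = x := by simp [hγ]
  have e1 : γ 1 = y := by simp [hγ]
  simp only [e0, e1] at h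
  rw [← enorm_neg, neg_sub]
  have hc : Continuous fun s => fderiv ℝ w (γ s) :=
    (hw.continuous_fderiv (by norm_num)).comp hγc.continuous
  have hm : Continuous fun s => ‖fderiv ℝ w (γ s) ((2 * s) • (y - x))‖ₑ :=
    (hc.clm_apply (by fun_prop)).enorm
  have hdd : ∀ s, deriv (fun s => w (γ s)) s = fderiv ℝ w (γ s) ((2 * s) • (y - x)) :=
    fun s => (hd s).deriv
  simp only [hdd] at h
  calc ‖w y - w x‖ₑ ^ 2 ≤ (∫⁻ s in Set.Icc (0 : ℝ) 1, ‖fderiv ℝ w (γ s) ((2 * s) • (y - x))‖ₑ) ^ 2 :=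
        pow_le_pow_left' h 2
    _ = (∫⁻ s in Set.Ioc (0 : ℝ) 1, ‖fderiv ℝ w (γ s) ((2 * s) • (y - x))‖ₑ) ^ 2 := by
        rw [restrict_Ioc_eq_restrict_Icc]
    _ ≤ _ := sq_lintegral_le _ hm.measurable.aemeasurable
    _ = ∫⁻ s in Set.Ioc (0 : ℝ) 1, ‖fderiv ℝ w (γ s) ((2 * s) • (y - x))‖ₑ ^ 2 := by simp
    _ ≤ _ := by
        refine setLIntegral_mono' measurableSet_Ioc fun s hs => ?_
        have : ‖fderiv ℝ w (γ s) ((2 * s) • (y - x))‖ₑ ≤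
            ‖fderiv ℝ w (γ s)‖ₑ * (ENNReal.ofReal (2 * s) * ‖y - x‖ₑ) := by
          refine (ContinuousLinearMap.le_opENorm _ _).trans ?_
          rw [enorm_smul, Real.enorm_eq_ofReal (by linarith [hs.1])]
        refine (pow_le_pow_left' this 2).trans (le_of_eq ?_)
        rw [mul_pow, mul_pow, ENNReal.ofReal_mul (by norm_num), mul_pow, ENNReal.ofReal_pow hs.1.le]
        norm_num
        ring

theorem lintegral_comp_smul_sub {d : ℕ} (F : Space d → ℝ≥0∞) (hF : Measurable F)
    (a : Space d) {t : ℝ} (ht : 0 < t) :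
    ∫⁻ z, F (t⁻¹ • (z - a)) = ENNReal.ofReal t ^ d * ∫⁻ y, F y := by
  rw [lintegral_sub_right_eq_self (fun z => F (t⁻¹ • z)) a]
  have h := Measure.map_addHaar_smul (volume : Measure (Space d)) (inv_ne_zero ht.ne')
  rw [← lintegral_map (g := fun z => t⁻¹ • z) hF (measurable_const_smul _), h, lintegral_smul_measure]
  congr 1
  rw [abs_of_pos (by positivity), ← ENNReal.ofReal_pow ht.le]
  simp

/-- The distribution of `(1 - t) x + t y`, where `x` is distributed by a measure of dimension at
least `d - 1` and `y` uniformly on a bounded set, has a density of order `1 / t`. -/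
theorem lintegral_segment_le {d : ℕ} (hd : 1 ≤ d) {Ω B : Set (Space d)} (hΩ : IsOpen Ω)
    (hB : MeasurableSet B) {μ : Measure (Space d)} [IsFiniteMeasure μ] {R : ℝ} (hR : 0 < R)
    (hBR : B ⊆ Metric.closedBall 0 R) {M : ℝ≥0∞}
    (hreg : ∀ x ρ, 0 < ρ → μ (Metric.closedBall x ρ) ≤ M * ENNReal.ofReal ρ ^ (d - 1))
    (hseg : ∀ᵐ x ∂μ, ∀ y ∈ B, ∀ t : ℝ, 0 < t → t ≤ 1 → (1 - t) • x + t • y ∈ Ω)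
    {G : Space d → ℝ≥0∞} (hG : Measurable G) {t : ℝ} (ht : 0 < t) (ht1 : t ≤ 1) :
    ENNReal.ofReal t * ∫⁻ x, (∫⁻ y in B, G ((1 - t) • x + t • y)) ∂μ ≤
      2 ^ (d - 1) * (M * ENNReal.ofReal R ^ (d - 1) + μ Set.univ) * ∫⁻ z in Ω, G z := by
  set K := 2 ^ (d - 1) * (M * ENNReal.ofReal R ^ (d - 1) + μ Set.univ) with hK
  set H := Ω.indicator G with hH
  have hHm : Measurable H := hG.indicator hΩ.measurableSet
  -- Substitute `z = (1 - t) x + t y` for fixed `x`: the Jacobian is `t ^ d`, and `z` stays in `Ω`,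
  -- so `G` may be cut off there.
  have hpt : ∀ᵐ x ∂μ, ENNReal.ofReal t ^ d * ∫⁻ y in B, G ((1 - t) • x + t • y) =
      ∫⁻ z, B.indicator (fun _ => 1) (t⁻¹ • (z - (1 - t) • x)) * H z := by
    filter_upwards [hseg] with x hx
    have hm : Measurable fun y : Space d => H ((1 - t) • x + t • y) :=
      hHm.comp (by fun_prop)
    rw [← lintegral_indicator hB]
    have h1 : (fun y => B.indicator (fun y => G ((1 - t) • x + t • y)) y) =
        B.indicator (fun y => H ((1 - t) • x + t • y)) := by
      ext y
      by_cases hy : y ∈ B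
      · simp [hy, hH, hx y hy t ht ht1]
      · simp [hy]
    rw [h1, ← lintegral_comp_smul_sub _ (hm.indicator hB) ((1 - t) • x) ht]
    congr 1
    ext z
    by_cases hy : t⁻¹ • (z - (1 - t) • x) ∈ B
    · simp [hy, smul_smul, ht.ne']
    · simp [hy]
  have hmass : ∀ z, ∫⁻ x, B.indicator (fun _ => 1) (t⁻¹ • (z - (1 - t) • x)) ∂μ ≤
      K * ENNReal.ofReal t ^ (d - 1) := by
    intro z
    have hmm : Measurable fun x : Space d => t⁻¹ • (z - (1 - t) • x) := by fun_prop
    have e : (fun x => B.indicator (fun _ => (1 : ℝ≥0∞)) (t⁻¹ • (z - (1 - t) • x))) =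
        ((fun x : Space d => t⁻¹ • (z - (1 - t) • x)) ⁻¹' B).indicator (fun _ => 1) := by
      ext x; rfl
    rw [e, lintegral_indicator (hmm hB), lintegral_one, Measure.restrict_apply_univ]
    -- For fixed `z`, the contributing `x` lie within `t R / (1 - t) ≤ 2 t R` of `z / (1 - t)`, and
    -- the growth of `μ` supplies `t ^ (d - 1)`. For `t > 1 / 2` the total mass suffices, because `2
    -- t ≥ 1`.
    by_cases h2 : t ≤ 1 / 2
    · have hsub : ((fun x : Space d => t⁻¹ • (z - (1 - t) • x)) ⁻¹' B) ⊆
          Metric.closedBall ((1 - t)⁻¹ • z) (2 * t * R) := by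
        intro x hx
        have h3 := hBR hx
        have ht' : 0 < 1 - t := by linarith
        rw [mem_closedBall_zero_iff, norm_smul, norm_inv, Real.norm_of_nonneg ht.le,
          inv_mul_le_iff₀ ht] at h3
        rw [Metric.mem_closedBall, dist_comm, dist_eq_norm]
        have e : (1 - t)⁻¹ • z - x = (1 - t)⁻¹ • (z - (1 - t) • x) := by
          rw [smul_sub, smul_smul, inv_mul_cancel₀ ht'.ne', one_smul]
        rw [e, norm_smul, norm_inv, Real.norm_of_nonneg ht'.le, inv_mul_le_iff₀ ht']
        nlinarith [mul_pos ht hR]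
      calc _ ≤ _ := measure_mono hsub
        _ ≤ _ := hreg _ _ (by positivity)
        _ = 2 ^ (d - 1) * (M * ENNReal.ofReal R ^ (d - 1)) * ENNReal.ofReal t ^ (d - 1) := by
            rw [ENNReal.ofReal_mul (by positivity), ENNReal.ofReal_mul (by positivity),
              mul_pow, mul_pow]
            norm_num
            ring
        _ ≤ _ := by rw [hK]; gcongr; exact le_self_add
    · push Not at h2
      have h4 : 1 ≤ (2 : ℝ≥0∞) ^ (d - 1) * ENNReal.ofReal t ^ (d - 1) := by
        rw [← mul_pow]
        apply one_le_pow₀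
        rw [← ENNReal.ofReal_ofNat 2, ← ENNReal.ofReal_mul (by norm_num), ← ENNReal.ofReal_one]
        exact ENNReal.ofReal_le_ofReal (by linarith)
      calc _ ≤ μ Set.univ := measure_mono (Set.subset_univ _)
        _ ≤ μ Set.univ * ((2 : ℝ≥0∞) ^ (d - 1) * ENNReal.ofReal t ^ (d - 1)) :=
            le_mul_of_one_le_right' h4
        _ = 2 ^ (d - 1) * (μ Set.univ) * ENNReal.ofReal t ^ (d - 1) := by ring
        _ ≤ _ := by rw [hK]; gcongr; exact le_add_self
  have hjoint : Measurable fun p : Space d × Space d =>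
      B.indicator (fun _ => (1 : ℝ≥0∞)) (t⁻¹ • (p.2 - (1 - t) • p.1)) * H p.2 :=
    ((measurable_const.indicator hB).comp (by fun_prop)).mul (hHm.comp measurable_snd)
  have hGm : Measurable fun x => ∫⁻ y in B, G ((1 - t) • x + t • y) :=
    Measurable.lintegral_prod_right' (f := fun p : Space d × Space d => G ((1 - t) • p.1 + t • p.2))
      (hG.comp (by fun_prop))
  have key : ENNReal.ofReal t ^ d * ∫⁻ x, (∫⁻ y in B, G ((1 - t) • x + t • y)) ∂μ ≤
      K * ENNReal.ofReal t ^ (d - 1) * ∫⁻ z in Ω, G z := by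
    rw [← lintegral_const_mul _ hGm, lintegral_congr_ae hpt,
      lintegral_lintegral_swap hjoint.aemeasurable, ← lintegral_indicator hΩ.measurableSet,
      ← lintegral_const_mul _ hHm]
    refine lintegral_mono fun z => ?_
    rw [lintegral_mul_const]
    · exact mul_le_mul_left (hmass z) _
    · exact (measurable_const.indicator hB).comp (by fun_prop)
  -- Cancelling `t ^ (d - 1)` from `key` leaves exactly one power of `t` on the left.
  have h0 : ENNReal.ofReal t ^ (d - 1) ≠ 0 := by simp [ht]
  have hT : ENNReal.ofReal t ^ (d - 1) ≠ ⊤ := by simp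
  rw [← ENNReal.mul_le_mul_iff_right h0 hT, ← mul_assoc, ← pow_succ, Nat.sub_add_cancel hd]
  exact key.trans (le_of_eq (by ring))

/-- The mean oscillation of `C¹` functions between two measures is controlled by their
`H¹`-seminorm on `Ω`. -/
def PoincareRel {d : ℕ} (Ω : Set (Space d)) (ν₁ ν₂ : Measure (Space d)) : Prop :=
  ∃ C : ℝ≥0, ∀ w : Space d → ℝ, ContDiff ℝ 1 w →
    ∫⁻ x, ∫⁻ y, ‖w x - w y‖ₑ ^ 2 ∂ν₂ ∂ν₁ ≤ C * ∫⁻ z in Ω, ‖fderiv ℝ w z‖ₑ ^ 2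

/-- Integrate the path estimate over both endpoints and exchange the integrals, so that the path
parameter `s` is outermost. For each `s`, `lintegral_segment_le` at `t = s²` absorbs the weight `s²`
and gives a bound uniform in `s`. -/
theorem PoincareRel.of_segments {d : ℕ} (hd : 1 ≤ d) {Ω B : Set (Space d)} (hΩ : IsOpen Ω)
    (hB : MeasurableSet B) {μ : Measure (Space d)} [IsFiniteMeasure μ] {R : ℝ} (hR : 0 < R)
    (hBR : B ⊆ Metric.closedBall 0 R) {M : ℝ≥0}
    (hreg : ∀ x ρ, 0 < ρ → μ (Metric.closedBall x ρ) ≤ M * ENNReal.ofReal ρ ^ (d - 1))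
    (hμR : ∀ᵐ x ∂μ, x ∈ Metric.closedBall 0 R)
    (hseg : ∀ᵐ x ∂μ, ∀ y ∈ B, ∀ t : ℝ, 0 < t → t ≤ 1 → (1 - t) • x + t • y ∈ Ω) :
    PoincareRel Ω μ (volume.restrict B) := by
  set K := 2 ^ (d - 1) * (M * ENNReal.ofReal R ^ (d - 1) + μ Set.univ) with hK
  have hKt : K ≠ ⊤ := by
    refine ENNReal.mul_ne_top (by simp) (ENNReal.add_ne_top.2 ⟨?_, measure_ne_top _ _⟩)
    exact ENNReal.mul_ne_top (by simp) (by simp)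
  have hDt : 4 * ENNReal.ofReal (2 * R) ^ 2 * K ≠ ⊤ := ENNReal.mul_ne_top (by finiteness) hKt
  refine ⟨(4 * ENNReal.ofReal (2 * R) ^ 2 * K).toNNReal, fun w hw => ?_⟩
  rw [ENNReal.coe_toNNReal hDt]
  set D := 4 * ENNReal.ofReal (2 * R) ^ 2 with hD
  have hcf : Continuous (fderiv ℝ w) := hw.continuous_fderiv (by norm_num)
  have hGm : Measurable fun z => ‖fderiv ℝ w z‖ₑ ^ 2 := hcf.enorm.measurable.pow_const 2
  have hF : Measurable fun p : (Space d × Space d) × ℝ => ENNReal.ofReal (p.2 ^ 2) *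
      ‖fderiv ℝ w ((1 - p.2 ^ 2) • p.1.1 + p.2 ^ 2 • p.1.2)‖ₑ ^ 2 := by
    refine Measurable.mul (by fun_prop) (hGm.comp (by fun_prop))
  calc ∫⁻ x, (∫⁻ y in B, ‖w x - w y‖ₑ ^ 2) ∂μ
      ≤ ∫⁻ x, (∫⁻ y in B, D * ∫⁻ s in Set.Ioc (0 : ℝ) 1, (ENNReal.ofReal (s ^ 2) *
        ‖fderiv ℝ w ((1 - s ^ 2) • x + s ^ 2 • y)‖ₑ ^ 2)) ∂μ := by
        refine lintegral_mono_ae ?_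
        filter_upwards [hμR] with x hx
        refine setLIntegral_mono' hB fun y hy => ?_
        refine (enorm_sub_sq_le_lintegral_path hw x y).trans ?_
        rw [lintegral_const_mul]
        · gcongr
          rw [hD, ← ofReal_norm]
          gcongr
          have h1 := hBR hy
          rw [mem_closedBall_zero_iff] at h1 hx
          linarith [norm_sub_le y x]
        · exact hF.comp (g := fun p : (Space d × Space d) × ℝ => _)
            (f := fun s : ℝ => ((x, y), s)) (by fun_prop)
    _ = D * ∫⁻ p in Set.Ioc (0 : ℝ) 1, ENNReal.ofReal (p ^ 2) * ∫⁻ x, (∫⁻ y in B,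
        ‖fderiv ℝ w ((1 - p ^ 2) • x + p ^ 2 • y)‖ₑ ^ 2) ∂μ := by
        have hm2 : Measurable fun p : Space d × Space d => ∫⁻ s in Set.Ioc (0 : ℝ) 1,
          (ENNReal.ofReal (s ^ 2) * ‖fderiv ℝ w ((1 - s ^ 2) • p.1 + s ^ 2 • p.2)‖ₑ ^ 2) :=
          hF.lintegral_prod_right'
        have e1 : ∀ x, ∫⁻ y in B, D * ∫⁻ s in Set.Ioc (0 : ℝ) 1, (ENNReal.ofReal (s ^ 2) *
            ‖fderiv ℝ w ((1 - s ^ 2) • x + s ^ 2 • y)‖ₑ ^ 2) =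
            D * ∫⁻ s in Set.Ioc (0 : ℝ) 1, ∫⁻ y in B, (ENNReal.ofReal (s ^ 2) *
            ‖fderiv ℝ w ((1 - s ^ 2) • x + s ^ 2 • y)‖ₑ ^ 2) := by
          intro x
          rw [lintegral_const_mul]
          · rw [lintegral_lintegral_swap]
            exact (hF.comp (g := fun p : (Space d × Space d) × ℝ => _)
              (f := fun q : Space d × ℝ => ((x, q.1), q.2)) (by fun_prop)).aemeasurable
          · exact hm2.comp (f := fun y => (x, y)) (by fun_prop)
        have hm3 : Measurable fun q : Space d × ℝ => ∫⁻ y in B, (ENNReal.ofReal (q.2 ^ 2) *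
            ‖fderiv ℝ w ((1 - q.2 ^ 2) • q.1 + q.2 ^ 2 • y)‖ₑ ^ 2) :=
          Measurable.lintegral_prod_right' (f := fun p : (Space d × ℝ) × Space d =>
            (ENNReal.ofReal (p.1.2 ^ 2) *
            ‖fderiv ℝ w ((1 - p.1.2 ^ 2) • p.1.1 + p.1.2 ^ 2 • p.2)‖ₑ ^ 2))
            (hF.comp (f := fun p : (Space d × ℝ) × Space d => ((p.1.1, p.2), p.1.2))
              (by fun_prop))
        simp_rw [e1]
        rw [lintegral_const_mul _ hm3.lintegral_prod_right',
          lintegral_lintegral_swap hm3.aemeasurable]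
        congr 2
        ext s
        have hm4 : Measurable fun q : Space d × Space d =>
            ‖fderiv ℝ w ((1 - s ^ 2) • q.1 + s ^ 2 • q.2)‖ₑ ^ 2 := hGm.comp (by fun_prop)
        rw [← lintegral_const_mul _ hm4.lintegral_prod_right']
        congr 1
        ext x
        rw [lintegral_const_mul]
        exact hm4.comp (f := fun y => (x, y)) (by fun_prop)
    _ ≤ D * ∫⁻ p in Set.Ioc (0 : ℝ) 1, K * ∫⁻ z in Ω, ‖fderiv ℝ w z‖ₑ ^ 2 := by
        refine mul_le_mul_right (setLIntegral_mono' measurableSet_Ioc fun s hs => ?_) _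
        have h1 : s ^ 2 ≤ 1 := by nlinarith [hs.1, hs.2]
        exact lintegral_segment_le hd hΩ hB hR hBR hreg hseg hGm (by have := hs.1; positivity) h1
    _ = _ := by simp [mul_assoc]

namespace PoincareRel

variable {d : ℕ} {Ω : Set (Space d)} {ν₁ ν₂ ν₃ : Measure (Space d)}

theorem symm [SFinite ν₁] [SFinite ν₂] (h : PoincareRel Ω ν₁ ν₂) : PoincareRel Ω ν₂ ν₁ := by
  obtain ⟨C, hC⟩ := h
  refine ⟨C, fun w hw => ?_⟩
  have hc := hw.continuous
  rw [lintegral_lintegral_swap]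
  · refine le_trans (le_of_eq ?_) (hC w hw)
    congr! 4 with x y
    rw [← enorm_neg, neg_sub]
  · refine Measurable.aemeasurable ?_
    have : Continuous fun p : Space d × Space d => ‖w p.1 - w p.2‖ₑ := by fun_prop
    exact this.measurable.pow_const 2

theorem mono {ν₁' ν₂' : Measure (Space d)} (h : PoincareRel Ω ν₁ ν₂) (h₁ : ν₁' ≤ ν₁)
    (h₂ : ν₂' ≤ ν₂) : PoincareRel Ω ν₁' ν₂' := by
  obtain ⟨C, hC⟩ := h
  exact ⟨C, fun w hw => (lintegral_mono' h₁ fun x => lintegral_mono' h₂ le_rfl).trans (hC w hw)⟩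

/-- Insert an intermediate point `y`, use `(a + b)² ≤ 2 a² + 2 b²`, and average over `y` with
respect to `ν₂`; this is why `ν₂` must have positive mass. -/
theorem trans [IsFiniteMeasure ν₁] [IsFiniteMeasure ν₂] [IsFiniteMeasure ν₃] (h0 : ν₂ ≠ 0)
    (h : PoincareRel Ω ν₁ ν₂) (h' : PoincareRel Ω ν₂ ν₃) : PoincareRel Ω ν₁ ν₃ := by
  obtain ⟨C, hC⟩ := h
  obtain ⟨C', hC'⟩ := h'
  have hm0 : ν₂ Set.univ ≠ 0 := by simpa using h0
  set K := (ν₂ Set.univ)⁻¹ * (2 * ν₃ Set.univ * C + 2 * ν₁ Set.univ * C') with hK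
  have hKt : K ≠ ⊤ := by
    refine ENNReal.mul_ne_top (by simpa using hm0) ?_
    finiteness
  refine ⟨K.toNNReal, fun w hw => ?_⟩
  rw [ENNReal.coe_toNNReal hKt]
  have hc := hw.continuous
  set J := ∫⁻ z in Ω, ‖fderiv ℝ w z‖ₑ ^ 2
  have hpt : ∀ x y z, ‖w x - w z‖ₑ ^ 2 ≤ 2 * ‖w x - w y‖ₑ ^ 2 + 2 * ‖w y - w z‖ₑ ^ 2 := by
    intro x y z
    simp only [← ofReal_norm, ← ENNReal.ofReal_pow (norm_nonneg _)]
    rw [← ENNReal.ofReal_ofNat 2, ← ENNReal.ofReal_mul (by norm_num),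
      ← ENNReal.ofReal_mul (by norm_num), ← ENNReal.ofReal_add (by positivity) (by positivity)]
    refine ENNReal.ofReal_le_ofReal ?_
    simp only [Real.norm_eq_abs, sq_abs]
    nlinarith [sq_nonneg ((w x - w y) - (w y - w z))]
  have mes : ∀ z, Measurable fun x => ‖w x - w z‖ₑ ^ 2 := fun z =>
    (show Continuous fun x => ‖w x - w z‖ₑ by fun_prop).measurable.pow_const 2
  have mes' : ∀ z, Measurable fun x => ‖w z - w x‖ₑ ^ 2 := fun z =>
    (show Continuous fun x => ‖w z - w x‖ₑ by fun_prop).measurable.pow_const 2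
  have mes2 : Measurable fun p : Space d × Space d => ‖w p.1 - w p.2‖ₑ ^ 2 :=
    (show Continuous fun p : Space d × Space d => ‖w p.1 - w p.2‖ₑ by
      fun_prop).measurable.pow_const 2
  have key : ν₂ Set.univ * ∫⁻ x, ∫⁻ z, ‖w x - w z‖ₑ ^ 2 ∂ν₃ ∂ν₁ ≤
      2 * ν₃ Set.univ * (∫⁻ x, ∫⁻ y, ‖w x - w y‖ₑ ^ 2 ∂ν₂ ∂ν₁) +
      2 * ν₁ Set.univ * ∫⁻ y, ∫⁻ z, ‖w y - w z‖ₑ ^ 2 ∂ν₃ ∂ν₂ := by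
    calc ν₂ Set.univ * ∫⁻ x, ∫⁻ z, ‖w x - w z‖ₑ ^ 2 ∂ν₃ ∂ν₁
        = ∫⁻ x, ∫⁻ _y, ∫⁻ z, ‖w x - w z‖ₑ ^ 2 ∂ν₃ ∂ν₂ ∂ν₁ := by
          simp only [lintegral_const]
          rw [lintegral_mul_const, mul_comm]
          exact mes2.lintegral_prod_right'
      _ ≤ ∫⁻ x, ∫⁻ y, (∫⁻ z, (2 * ‖w x - w y‖ₑ ^ 2 + 2 * ‖w y - w z‖ₑ ^ 2) ∂ν₃) ∂ν₂ ∂ν₁ :=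
          lintegral_mono fun x => lintegral_mono fun y => lintegral_mono fun z => hpt x y z
      _ = ∫⁻ x, ∫⁻ y, (2 * ν₃ Set.univ * ‖w x - w y‖ₑ ^ 2 +
            2 * ∫⁻ z, ‖w y - w z‖ₑ ^ 2 ∂ν₃) ∂ν₂ ∂ν₁ := by
          congr! 4 with x y
          rw [lintegral_add_left measurable_const, lintegral_const,
            lintegral_const_mul _ (mes' y)]
          ring
      _ = _ := by
          have e : ∀ x, ∫⁻ y, (2 * ν₃ Set.univ * ‖w x - w y‖ₑ ^ 2 +
              2 * ∫⁻ z, ‖w y - w z‖ₑ ^ 2 ∂ν₃) ∂ν₂ = 2 * ν₃ Set.univ *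
              (∫⁻ y, ‖w x - w y‖ₑ ^ 2 ∂ν₂) + 2 * ∫⁻ y, ∫⁻ z, ‖w y - w z‖ₑ ^ 2 ∂ν₃ ∂ν₂ := by
            intro x
            rw [lintegral_add_left ((mes' x).const_mul _), lintegral_const_mul _ (mes' x),
              lintegral_const_mul _ mes2.lintegral_prod_right']
          simp only [e]
          rw [lintegral_add_right _ measurable_const, lintegral_const,
            lintegral_const_mul _ mes2.lintegral_prod_right']
          ring
  calc ∫⁻ x, ∫⁻ z, ‖w x - w z‖ₑ ^ 2 ∂ν₃ ∂ν₁
      = (ν₂ Set.univ)⁻¹ * (ν₂ Set.univ * ∫⁻ x, ∫⁻ z, ‖w x - w z‖ₑ ^ 2 ∂ν₃ ∂ν₁) := by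
        rw [← mul_assoc, ENNReal.inv_mul_cancel hm0 (measure_ne_top _ _), one_mul]
    _ ≤ (ν₂ Set.univ)⁻¹ * (2 * ν₃ Set.univ * (C * J) + 2 * ν₁ Set.univ * (C' * J)) := by
        refine mul_le_mul_right (key.trans ?_) _
        gcongr
        · exact hC w hw
        · exact hC' w hw
    _ = K * J := by rw [hK]; ring

theorem of_le_sum {ι : Type*} {s : Finset ι} {μ : ι → Measure (Space d)}
    (h : ∀ i ∈ s, PoincareRel Ω (μ i) ν₂) (hle : ν₁ ≤ ∑ i ∈ s, μ i) : PoincareRel Ω ν₁ ν₂ := by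
  classical
  choose! C hC using h
  refine ⟨∑ i ∈ s, C i, fun w hw => (lintegral_mono' hle le_rfl).trans ?_⟩
  rw [lintegral_finsetSum_measure]
  push_cast
  rw [Finset.sum_mul]
  exact Finset.sum_le_sum fun i hi => hC i hi w hw

end PoincareRel

/-! ### Connecting the parts of a domain -/

/-- Lets `PoincareRel.of_segments` treat volume like surface measure: small balls satisfy `ρ ^ d ≤ ρ
^ (d - 1)`, and for large ones the total mass is enough. -/
theorem volume_restrict_closedBall_le {d : ℕ} {S : Set (Space d)}
    (hS : Bornology.IsBounded S) : ∃ M : ℝ≥0, ∀ x ρ, 0 < ρ →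
      (volume.restrict S) (Metric.closedBall x ρ) ≤ M * ENNReal.ofReal ρ ^ (d - 1) := by
  have hS' : volume S ≠ ⊤ := hS.measure_lt_top.ne
  have hB : volume (Metric.ball (0 : Space d) 1) ≠ ⊤ := measure_ball_lt_top.ne
  refine ⟨(volume S).toNNReal + (volume (Metric.ball (0 : Space d) 1)).toNNReal,
    fun x ρ hρ => ?_⟩
  push_cast
  rw [ENNReal.coe_toNNReal hS', ENNReal.coe_toNNReal hB]
  by_cases h1 : ρ ≤ 1
  · calc _ ≤ volume (Metric.closedBall x ρ) := Measure.restrict_apply_le _ _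
      _ = ENNReal.ofReal ρ ^ d * volume (Metric.ball (0 : Space d) 1) := by
          rw [Measure.addHaar_closedBall _ _ hρ.le, finrank_euclideanSpace_fin,
            ENNReal.ofReal_pow hρ.le]
      _ ≤ ENNReal.ofReal ρ ^ (d - 1) * volume (Metric.ball (0 : Space d) 1) := by
          gcongr ?_ * _
          exact pow_le_pow_right_of_le_one' (ENNReal.ofReal_le_one.2 h1) (Nat.sub_le _ _)
      _ ≤ _ := by rw [mul_comm]; gcongr; exact le_add_self
  · push Not at h1
    have h4 : 1 ≤ ENNReal.ofReal ρ ^ (d - 1) :=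
      one_le_pow₀ (by rw [← ENNReal.ofReal_one]; exact ENNReal.ofReal_le_ofReal h1.le)
    calc _ ≤ volume S := by
          rw [Measure.restrict_apply Metric.isClosed_closedBall.measurableSet]
          exact measure_mono Set.inter_subset_right
      _ ≤ volume S * ENNReal.ofReal ρ ^ (d - 1) := le_mul_of_one_le_right' h4
      _ ≤ _ := by gcongr; exact le_self_add

theorem isFiniteMeasure_restrict_of_isBounded {d : ℕ} {S : Set (Space d)}
    (hS : Bornology.IsBounded S) : IsFiniteMeasure (volume.restrict S) :=
  ⟨by simpa using hS.measure_lt_top⟩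

theorem PoincareRel.of_convex {d : ℕ} (hd : 1 ≤ d) {Ω K S B : Set (Space d)} (hΩ : IsOpen Ω)
    (hK : Convex ℝ K) (hKΩ : K ⊆ Ω) (hKb : Bornology.IsBounded K) (hS : MeasurableSet S)
    (hB : MeasurableSet B) (hSK : S ⊆ K) (hBK : B ⊆ K) :
    PoincareRel Ω (volume.restrict S) (volume.restrict B) := by
  obtain ⟨R, hR, hKR⟩ := hKb.subset_closedBall_lt 0 0
  obtain ⟨M, hM⟩ := volume_restrict_closedBall_le (hKb.subset hSK)
  have := isFiniteMeasure_restrict_of_isBounded (hKb.subset hSK)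
  refine PoincareRel.of_segments hd hΩ hB hR (hBK.trans hKR) hM ?_ ?_
  · filter_upwards [ae_restrict_mem hS] with x hx using hKR (hSK hx)
  · filter_upwards [ae_restrict_mem hS] with x hx y hy t ht ht1
    exact hKΩ (hK (hSK hx) (hBK hy) (by linarith) ht.le (by ring))

theorem restrict_ball_ne_zero {d : ℕ} (x : Space d) {ρ : ℝ} (hρ : 0 < ρ) :
    volume.restrict (Metric.ball x ρ) ≠ 0 := by
  rw [Ne, Measure.restrict_eq_zero]
  exact (Metric.measure_ball_pos _ _ hρ).ne'

/-- Two balls that overlap in a ball are related by convexity, and connectedness of `Ω` turns this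
local fact into a global one through chains. -/
theorem PoincareRel.ball_ball {d : ℕ} (hd : 1 ≤ d) {Ω : Set (Space d)} (hΩ : IsOpen Ω)
    (hΩc : IsPreconnected Ω) {x y : Space d} {ρ ρ' : ℝ} (hρ : 0 < ρ) (hρ' : 0 < ρ')
    (hx : Metric.ball x ρ ⊆ Ω) (hy : Metric.ball y ρ' ⊆ Ω) :
    PoincareRel Ω (volume.restrict (Metric.ball x ρ)) (volume.restrict (Metric.ball y ρ')) := by
  have hfin : ∀ (x : Space d) (ρ : ℝ), IsFiniteMeasure (volume.restrict (Metric.ball x ρ)) :=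
    fun x ρ => isFiniteMeasure_restrict_of_isBounded Metric.isBounded_ball
  have hconv : ∀ (x : Space d) (ρ : ℝ) (S B : Set (Space d)), Metric.ball x ρ ⊆ Ω →
      MeasurableSet S → MeasurableSet B → S ⊆ Metric.ball x ρ → B ⊆ Metric.ball x ρ →
      PoincareRel Ω (volume.restrict S) (volume.restrict B) := fun x ρ S B h hS hB hSK hBK =>
    PoincareRel.of_convex hd hΩ (convex_ball x ρ) h Metric.isBounded_ball hS hB hSK hBK
  -- All radii are quantified inside the induction predicate, so that transitivity may choose any
  -- radius at the intermediate centre.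
  refine hΩc.induction₂ (fun x y => ∀ ρ ρ', 0 < ρ → 0 < ρ' → Metric.ball x ρ ⊆ Ω →
    Metric.ball y ρ' ⊆ Ω → PoincareRel Ω (volume.restrict (Metric.ball x ρ))
    (volume.restrict (Metric.ball y ρ'))) ?_ ?_ ?_ (hx (Metric.mem_ball_self hρ))
    (hy (Metric.mem_ball_self hρ')) ρ ρ' hρ hρ' hx hy
  · intro x hx
    obtain ⟨ε, hε, hεΩ⟩ := Metric.isOpen_iff.1 hΩ x hx
    refine eventually_nhdsWithin_of_eventually_nhds ?_
    filter_upwards [Metric.ball_mem_nhds x hε] with y hy ρ ρ' hρ hρ' hρΩ hρΩ'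
    have h1 : PoincareRel Ω (volume.restrict (Metric.ball x ρ))
        (volume.restrict (Metric.ball x ε)) := by
      rcases le_total ρ ε with h | h
      · exact hconv x ε _ _ hεΩ measurableSet_ball measurableSet_ball
          (Metric.ball_subset_ball h) le_rfl
      · exact hconv x ρ _ _ hρΩ measurableSet_ball measurableSet_ball le_rfl
          (Metric.ball_subset_ball h)
    -- The ball of radius `δ` about `y` lies in both larger balls and serves as the link between
    -- them.
    have hδ : 0 < min ρ' (ε - dist y x) := lt_min hρ' (by simpa using hy)
    set δ := min ρ' (ε - dist y x)
    have hs1 : Metric.ball y δ ⊆ Metric.ball x ε :=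
      Metric.ball_subset_ball' (by have := min_le_right ρ' (ε - dist y x); linarith)
    have hs2 : Metric.ball y δ ⊆ Metric.ball y ρ' := Metric.ball_subset_ball (min_le_left _ _)
    have h2 := hconv x ε _ _ hεΩ measurableSet_ball measurableSet_ball le_rfl hs1
    have h3 := hconv y ρ' _ _ hρΩ' measurableSet_ball measurableSet_ball hs2 le_rfl
    exact (h1.trans (restrict_ball_ne_zero x hε) h2).trans (restrict_ball_ne_zero y hδ) h3
  · intro x y z hx hy hz hxy hyz ρ ρ' hρ hρ' hρΩ hρΩ'
    obtain ⟨ε, hε, hεΩ⟩ := Metric.isOpen_iff.1 hΩ y hy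
    exact (hxy ρ ε hρ hε hρΩ hεΩ).trans (restrict_ball_ne_zero y hε) (hyz ε ρ' hε hρ' hεΩ hρΩ')
  · intro x y hx hy hxy ρ ρ' hρ hρ' hρΩ hρΩ'
    exact (hxy ρ' ρ hρ' hρ hρΩ' hρΩ).symm

/-! ### Surface measure -/

theorem volume_hyperplane {d : ℕ} {n : Space d} (hn : n ≠ 0) (c : ℝ) :
    volume {x : Space d | ⟪n, x⟫_ℝ = c} = 0 := by
  rcases Set.eq_empty_or_nonempty {x : Space d | ⟪n, x⟫_ℝ = c} with h | ⟨p, hp⟩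
  · simp [h]
  · have e : {x : Space d | ⟪n, x⟫_ℝ = c} = (fun x => x + -p) ⁻¹' ((ℝ ∙ n)ᗮ : Submodule ℝ _) := by
      ext x
      simp only [Set.mem_ofPred_eq, Set.mem_preimage, SetLike.mem_coe,
        Submodule.mem_orthogonal_singleton_iff_inner_right] at hp ⊢
      rw [inner_add_right, inner_neg_right, hp, ← sub_eq_add_neg, sub_eq_zero]
    rw [e, measure_preimage_add_right]
    refine Measure.addHaar_submodule _ _ fun h => hn ?_
    have : n ∈ (ℝ ∙ n)ᗮ := h ▸ Submodule.mem_top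
    rwa [Submodule.mem_orthogonal_singleton_iff_inner_right, inner_self_eq_zero] at this

theorem finrank_orthogonal_singleton {d : ℕ} {n : Space d} (hn : n ≠ 0) :
    Module.finrank ℝ (ℝ ∙ n)ᗮ = d - 1 := by
  have h := Submodule.finrank_add_finrank_orthogonal (ℝ ∙ n)
  rw [finrank_span_singleton hn, finrank_euclideanSpace_fin] at h
  omega

/-- The hyperplane is an isometric copy of the orthogonal complement of `n`, on which the normalized
Hausdorff measure is Lebesgue measure. -/
theorem hausdorff_hyperplane_inter_closedBall_le {d : ℕ} {n : Space d} (hn : n ≠ 0) (c : ℝ) :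
    ∃ M : ℝ≥0, ∀ x ρ, 0 < ρ → (μHE[d - 1] : Measure (Space d))
      ({x : Space d | ⟪n, x⟫_ℝ = c} ∩ Metric.closedBall x ρ) ≤ M * ENNReal.ofReal ρ ^ (d - 1) := by
  set V := (ℝ ∙ n)ᗮ with hV
  have hVd : Module.finrank ℝ V = d - 1 := finrank_orthogonal_singleton hn
  have hB : volume (Metric.closedBall (0 : V) 1) ≠ ⊤ := measure_closedBall_lt_top.ne
  -- The centre `x` may lie off the hyperplane. Recentring at a point `p` of the intersection
  -- doubles the radius, whence `2 ^ (d - 1)`.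
  refine ⟨2 ^ (d - 1) * (volume (Metric.closedBall (0 : V) 1)).toNNReal, fun x ρ hρ => ?_⟩
  rcases Set.eq_empty_or_nonempty ({x : Space d | ⟪n, x⟫_ℝ = c} ∩ Metric.closedBall x ρ)
    with h | ⟨p, hp, hpx⟩
  · simp [h]
  have hf : Isometry fun v : V => p + (v : Space d) :=
    (isometry_add_left p).comp isometry_subtype_coe
  have hsub : {x : Space d | ⟪n, x⟫_ℝ = c} ∩ Metric.closedBall x ρ ⊆
      (fun v : V => p + (v : Space d)) '' Metric.closedBall 0 (2 * ρ) := by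
    rintro y ⟨hy, hyx⟩
    have hyV : y - p ∈ V := by
      rw [hV, Submodule.mem_orthogonal_singleton_iff_inner_right, inner_sub_right, sub_eq_zero]
      exact hy.trans hp.symm
    refine ⟨⟨y - p, hyV⟩, ?_, by simp⟩
    rw [mem_closedBall_zero_iff]
    change ‖y - p‖ ≤ 2 * ρ
    rw [← dist_eq_norm]
    have := dist_triangle_right y p x
    rw [Metric.mem_closedBall] at hyx hpx
    linarith
  calc _ ≤ _ := measure_mono hsub
    _ = volume (Metric.closedBall (0 : V) (2 * ρ)) := by
        rw [hf.euclideanHausdorffMeasure_image, ← hVd,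
          InnerProductSpace.euclideanHausdorffMeasure_eq_volume]
    _ = _ := by
        rw [Measure.addHaar_closedBall' _ _ (by positivity), hVd, mul_pow,
          ENNReal.ofReal_mul (by positivity), ENNReal.ofReal_pow hρ.le,
          ENNReal.ofReal_pow (by norm_num)]
        push_cast
        rw [ENNReal.coe_toNNReal hB]
        norm_num
        ring

theorem surfaceMeasure_closedBall_le {d : ℕ} {Ω : Set (Space d)} (hΩ : IsPolyhedralDomain Ω) :
    ∃ M : ℝ≥0, ∀ x ρ, 0 < ρ →
      surfaceMeasure Ω (Metric.closedBall x ρ) ≤ M * ENNReal.ofReal ρ ^ (d - 1) := by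
  obtain ⟨F, hF, hΓ⟩ := hΩ.flat_boundary
  have h : ∀ q : Space d × ℝ, q ∈ F → ∃ M : ℝ≥0, ∀ x ρ, 0 < ρ → (μHE[d - 1] : Measure (Space d))
      ({x : Space d | ⟪q.1, x⟫_ℝ = q.2} ∩ Metric.closedBall x ρ) ≤
        M * ENNReal.ofReal ρ ^ (d - 1) :=
    fun q hq => hausdorff_hyperplane_inter_closedBall_le (hF q hq) q.2
  choose! M hM using h
  refine ⟨∑ q ∈ F, M q, fun x ρ hρ => ?_⟩
  rw [surfaceMeasure, Measure.restrict_apply Metric.isClosed_closedBall.measurableSet]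
  calc _ ≤ (μHE[d - 1] : Measure (Space d))
        (⋃ q ∈ F, ({x : Space d | ⟪q.1, x⟫_ℝ = q.2} ∩ Metric.closedBall x ρ)) := by
        refine measure_mono fun y hy => ?_
        obtain ⟨q, hq, hqy⟩ := hΓ y hy.2
        simp only [Set.mem_iUnion]
        exact ⟨q, hq, hqy, hy.1⟩
    _ ≤ _ := measure_biUnion_finset_le _ _
    _ ≤ ∑ q ∈ F, (M q : ℝ≥0∞) * ENNReal.ofReal ρ ^ (d - 1) :=
        Finset.sum_le_sum fun q hq => hM q hq x ρ hρ
    _ = _ := by push_cast; rw [Finset.sum_mul]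

theorem isBounded_frontier {d : ℕ} {Ω : Set (Space d)} (hΩ : Bornology.IsBounded Ω) :
    Bornology.IsBounded (frontier Ω) :=
  hΩ.closure.subset frontier_subset_closure

theorem isFiniteMeasure_surfaceMeasure {d : ℕ} {Ω : Set (Space d)} (hΩ : IsPolyhedralDomain Ω) :
    IsFiniteMeasure (surfaceMeasure Ω) := by
  obtain ⟨M, hM⟩ := surfaceMeasure_closedBall_le hΩ
  obtain ⟨R, hR, hsub⟩ := (isBounded_frontier hΩ.isBounded).subset_closedBall_lt 0 0
  refine ⟨?_⟩
  have h : surfaceMeasure Ω Set.univ ≤ surfaceMeasure Ω (Metric.closedBall 0 R) := by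
    rw [surfaceMeasure, Measure.restrict_apply_univ,
      Measure.restrict_apply Metric.isClosed_closedBall.measurableSet]
    exact measure_mono fun x hx => ⟨hsub hx, hx⟩
  refine (h.trans (hM 0 R hR)).trans_lt ?_
  finiteness

theorem subset_of_disjoint_frontier {α : Type*} [TopologicalSpace α] {K Ω : Set α}
    (hK : IsPreconnected K) (hΩ : IsOpen Ω) (hd : ∀ x ∈ K, x ∉ frontier Ω)
    (hne : (K ∩ Ω).Nonempty) : K ⊆ Ω := by
  refine hK.subset_of_closure_inter_subset hΩ hne fun x hx => ?_
  by_contra h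
  exact hd x hx.2 ⟨hx.1, by rwa [hΩ.interior_eq]⟩

/-- Every line in direction `n` through a ball of `Ω` must leave the bounded set `Ω`, hence meets
the frontier. So the projection of the frontier along `n` contains a `(d-1)`-ball, while a
1-Lipschitz map sends Hausdorff null sets to null sets. -/
theorem surfaceMeasure_ne_zero {d : ℕ} (hd : 1 ≤ d) {Ω : Set (Space d)}
    (hΩ : IsPolyhedralDomain Ω) : surfaceMeasure Ω ≠ 0 := by
  intro h0
  have h1 : (μHE[d - 1] : Measure (Space d)) (frontier Ω) = 0 := by
    rw [← Measure.restrict_apply_univ]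
    change surfaceMeasure Ω Set.univ = 0
    simp [h0]
  have : Nonempty (Fin d) := ⟨⟨0, hd⟩⟩
  obtain ⟨n, hn⟩ := exists_ne (0 : Space d)
  set V := (ℝ ∙ n)ᗮ with hV
  have hVd : Module.finrank ℝ V = d - 1 := finrank_orthogonal_singleton hn
  obtain ⟨x₀, hx₀⟩ := hΩ.isConnected.nonempty
  obtain ⟨ρ, hρ, hball⟩ := Metric.isOpen_iff.1 hΩ.isOpen x₀ hx₀
  have hsub : Metric.ball (V.orthogonalProjectionOnto x₀) ρ ⊆
      V.orthogonalProjectionOnto '' frontier Ω := by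
    intro u hu
    by_contra hnot
    set z : Space d := x₀ + ((u : Space d) - V.orthogonalProjectionOnto x₀) with hz
    have hzΩ : z ∈ Ω := by
      apply hball
      rw [Metric.mem_ball, dist_eq_norm] at hu ⊢
      rw [hz, add_sub_cancel_left]
      exact hu
    have hproj : ∀ t : ℝ, V.orthogonalProjectionOnto (z + t • n) = u := by
      intro t
      have hnV : V.orthogonalProjectionOnto n = 0 := by
        rw [Submodule.orthogonalProjectionOnto_eq_zero_iff, hV, Submodule.orthogonal_orthogonal]
        exact Submodule.mem_span_singleton_self n
      rw [hz, map_add, map_add, map_sub, map_smul, hnV,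
        Submodule.orthogonalProjectionOnto_mem_subspace_eq_self,
        Submodule.orthogonalProjectionOnto_mem_subspace_eq_self]
      simp
    have hline : Set.range (fun t : ℝ => z + t • n) ⊆ Ω := by
      refine subset_of_disjoint_frontier (isPreconnected_range (by fun_prop)) hΩ.isOpen ?_
        ⟨z, ⟨0, by simp⟩, hzΩ⟩
      rintro _ ⟨t, rfl⟩ hmem
      exact hnot ⟨_, hmem, hproj t⟩
    obtain ⟨R, hR, hRs⟩ := hΩ.isBounded.subset_closedBall_lt 0 0
    -- At this parameter the displacement from `z` has length `R + ‖z‖ + 1`, so the point lies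
    -- outside the ball of radius `R`.
    have h2 := hRs (hline ⟨(R + ‖z‖ + 1) / ‖n‖, rfl⟩)
    rw [mem_closedBall_zero_iff] at h2
    have h3 : ‖((R + ‖z‖ + 1) / ‖n‖) • n‖ = R + ‖z‖ + 1 := by
      rw [norm_smul, Real.norm_of_nonneg (by positivity),
        div_mul_cancel₀ _ (norm_ne_zero_iff.2 hn)]
    have h4 := norm_sub_le (z + ((R + ‖z‖ + 1) / ‖n‖) • n) z
    rw [add_sub_cancel_left, h3] at h4
    linarith
  have hlip : LipschitzWith 1 V.orthogonalProjectionOnto := V.lipschitzWith_orthogonalProjectionOnto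
  have h5 : (μHE[d - 1] : Measure V) (V.orthogonalProjectionOnto '' frontier Ω) = 0 := by
    rw [Measure.euclideanHausdorffMeasure_def, Measure.smul_apply] at h1 ⊢
    have hc := Measure.addHaarScalarFactor_volume_hausdorffMeasure_ne_zero (d - 1)
    have h6 : (μH[(d - 1 : ℕ)] : Measure (Space d)) (frontier Ω) = 0 := by
      rcases smul_eq_zero.1 h1 with h | h
      · exact absurd h hc
      · exact h
    have h7 := (hlip.lipschitzOnWith (s := frontier Ω)).hausdorffMeasure_image_le
      (d := ((d - 1 : ℕ) : ℝ)) (by positivity)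
    rw [h6, mul_zero, nonpos_iff_eq_zero] at h7
    rw [h7, smul_zero]
  rw [← hVd, InnerProductSpace.euclideanHausdorffMeasure_eq_volume] at h5
  exact (Metric.measure_ball_pos volume _ hρ).ne' (measure_mono_null hsub h5)

/-! ### Poincaré and trace inequality on polyhedral domains -/

theorem restrict_le_sum_restrict {α ι : Type*} [MeasurableSpace α] (μ : Measure α)
    {S : Set α} {s : Finset ι} {T : ι → Set α} (h : S ≤ᵐ[μ] ⋃ i ∈ s, T i) :
    μ.restrict S ≤ ∑ i ∈ s, μ.restrict (T i) := by
  refine (Measure.restrict_mono_ae h).trans (Measure.le_iff.2 fun A hA => ?_)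
  rw [Measure.finsetSum_apply, Measure.restrict_apply hA, Set.inter_iUnion₂]
  refine (measure_biUnion_finset_le _ _).trans (le_of_eq ?_)
  exact Finset.sum_congr rfl fun i _ => (Measure.restrict_apply hA).symm

/-- The open cell of an arrangement `F` of hyperplanes that lies on the positive side of the
hyperplanes in `A` and on the negative side of the others. -/
def arrangementCell {d : ℕ} (F A : Finset (Space d × ℝ)) : Set (Space d) :=
  {x | ∀ q ∈ F, (q ∈ A → q.2 < ⟪q.1, x⟫_ℝ) ∧ (q ∉ A → ⟪q.1, x⟫_ℝ < q.2)}

theorem convex_arrangementCell {d : ℕ} (F A : Finset (Space d × ℝ)) :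
    Convex ℝ (arrangementCell F A) := by
  intro x hx y hy a b ha hb hab q hq
  rw [inner_add_right, inner_smul_right, inner_smul_right]
  have e : q.2 = a * q.2 + b * q.2 := by rw [← add_mul, hab, one_mul]
  constructor
  · intro hA
    have h1 := (hx q hq).1 hA
    have h2 := (hy q hq).1 hA
    exact (convex_Ioi q.2) h1 h2 ha hb hab
  · intro hA
    have h1 := (hx q hq).2 hA
    have h2 := (hy q hq).2 hA
    exact (convex_Iio q.2) h1 h2 ha hb hab

theorem isOpen_arrangementCell {d : ℕ} (F A : Finset (Space d × ℝ)) :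
    IsOpen (arrangementCell F A) := by
  have e : arrangementCell F A = ⋂ q ∈ F, {x : Space d | (q ∈ A → q.2 < ⟪q.1, x⟫_ℝ) ∧
      (q ∉ A → ⟪q.1, x⟫_ℝ < q.2)} := by
    ext x; simp [arrangementCell]
  rw [e]
  refine isOpen_biInter_finset fun q _ => ?_
  by_cases hq : q ∈ A
  · simpa [hq] using isOpen_lt continuous_const (by fun_prop)
  · simpa [hq] using isOpen_lt (by fun_prop) continuous_const

theorem exists_mem_arrangementCell {d : ℕ} (F : Finset (Space d × ℝ)) {x : Space d}
    (hx : ∀ q ∈ F, ⟪q.1, x⟫_ℝ ≠ q.2) : ∃ A ∈ F.powerset, x ∈ arrangementCell F A := by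
  classical
  refine ⟨F.filter fun q => q.2 < ⟪q.1, x⟫_ℝ, Finset.mem_powerset.2 (Finset.filter_subset _ _),
    fun q hq => ⟨fun h => (Finset.mem_filter.1 h).2, fun h => ?_⟩⟩
  rw [Finset.mem_filter] at h
  exact lt_of_le_of_ne (not_lt.1 fun h' => h ⟨hq, h'⟩) (hx q hq)

/-- Both measures are related to one fixed ball: each cell, or its closure on `Γ`, is first related
to a small ball inside the cell, which is then joined to the fixed ball within `Ω`. -/
theorem IsPolyhedralDomain.poincareRel {d : ℕ} (hd : 1 ≤ d) {Ω : Set (Space d)}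
    (hΩ : IsPolyhedralDomain Ω) :
    PoincareRel Ω (surfaceMeasure Ω) (volume.restrict Ω) := by
  classical
  obtain ⟨F, hF, hΓ⟩ := hΩ.flat_boundary
  -- Cells that meet `Ω`. A cell avoids all hyperplanes of `F`, hence the frontier, so being
  -- connected it lies entirely in `Ω`.
  set I := F.powerset.filter fun A => (arrangementCell F A ∩ Ω).Nonempty with hI
  have hcellΩ : ∀ A ∈ I, arrangementCell F A ⊆ Ω := by
    intro A hA
    refine subset_of_disjoint_frontier (convex_arrangementCell F A).isPreconnected hΩ.isOpen ?_
      (Finset.mem_filter.1 hA).2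
    intro x hx hxf
    obtain ⟨q, hq, hqx⟩ := hΓ x hxf
    by_cases hqA : q ∈ A
    · exact ((hx q hq).1 hqA).ne' hqx
    · exact ((hx q hq).2 hqA).ne hqx
  set N : Set (Space d) := ⋃ q ∈ F, {x : Space d | ⟪q.1, x⟫_ℝ = q.2} with hN
  have hN0 : volume N = 0 :=
    (measure_biUnion_null_iff F.countable_toSet).2 fun q hq => volume_hyperplane (hF q hq) q.2
  have hcov : Ω ∩ Nᶜ ⊆ ⋃ A ∈ I, arrangementCell F A := by
    rintro x ⟨hxΩ, hxN⟩
    have hx : ∀ q ∈ F, ⟪q.1, x⟫_ℝ ≠ q.2 := by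
      intro q hq h
      exact hxN (Set.mem_biUnion (Finset.mem_coe.2 hq) h)
    obtain ⟨A, hA, hxA⟩ := exists_mem_arrangementCell F hx
    exact Set.mem_biUnion (Finset.mem_coe.2 (Finset.mem_filter.2 ⟨hA, x, hxA, hxΩ⟩)) hxA
  -- The hyperplanes form a null set, so their complement is dense; since there are finitely many
  -- cells, taking closures also covers the boundary.
  have hcl : closure Ω ⊆ ⋃ A ∈ I, closure (arrangementCell F A) := by
    have hdense : Dense Nᶜ := by
      have := Measure.dense_of_ae (μ := (volume : Measure (Space d))) (p := fun x => x ∈ Nᶜ)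
        (by rw [ae_iff]; simpa using hN0)
      exact this
    have h1 : closure Ω ⊆ closure (Ω ∩ Nᶜ) :=
      closure_minimal (hdense.open_subset_closure_inter hΩ.isOpen) isClosed_closure
    refine h1.trans ((closure_mono hcov).trans ?_)
    rw [I.closure_biUnion]
  obtain ⟨x₀, hx₀⟩ := hΩ.isConnected.nonempty
  obtain ⟨ρ, hρ, hball⟩ := Metric.isOpen_iff.1 hΩ.isOpen x₀ hx₀
  have hconn : ∀ A ∈ I, ∃ z δ, 0 < δ ∧ Metric.ball z δ ⊆ arrangementCell F A ∧
      PoincareRel Ω (volume.restrict (Metric.ball z δ)) (volume.restrict (Metric.ball x₀ ρ)) := by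
    intro A hA
    obtain ⟨z, hz, hzΩ⟩ := (Finset.mem_filter.1 hA).2
    obtain ⟨δ, hδ, hδs⟩ := Metric.isOpen_iff.1 (isOpen_arrangementCell F A) z hz
    exact ⟨z, δ, hδ, hδs, PoincareRel.ball_ball hd hΩ.isOpen hΩ.isConnected.isPreconnected hδ hρ
      (hδs.trans (hcellΩ A hA)) hball⟩
  have hfinB : ∀ (x : Space d) (ρ : ℝ), IsFiniteMeasure (volume.restrict (Metric.ball x ρ)) :=
    fun x ρ => isFiniteMeasure_restrict_of_isBounded Metric.isBounded_ball
  have hfinΩ := isFiniteMeasure_restrict_of_isBounded hΩ.isBounded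
  have hfinS := isFiniteMeasure_surfaceMeasure hΩ
  have hvol : PoincareRel Ω (volume.restrict Ω) (volume.restrict (Metric.ball x₀ ρ)) := by
    refine PoincareRel.of_le_sum (s := I) (μ := fun A => volume.restrict (arrangementCell F A)) ?_
      (restrict_le_sum_restrict _ ?_)
    · intro A hA
      obtain ⟨z, δ, hδ, hδs, hrel⟩ := hconn A hA
      have := isFiniteMeasure_restrict_of_isBounded (hΩ.isBounded.subset (hcellΩ A hA))
      exact (PoincareRel.of_convex hd hΩ.isOpen (convex_arrangementCell F A) (hcellΩ A hA)
        (hΩ.isBounded.subset (hcellΩ A hA)) (isOpen_arrangementCell F A).measurableSet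
        measurableSet_ball le_rfl hδs).trans (restrict_ball_ne_zero z hδ) hrel
    · have : ∀ᵐ x : Space d, x ∉ N := by rw [ae_iff]; simpa using hN0
      filter_upwards [this] with x hx hxΩ
      exact hcov ⟨hxΩ, hx⟩
  have hsurf : PoincareRel Ω (surfaceMeasure Ω) (volume.restrict (Metric.ball x₀ ρ)) := by
    refine PoincareRel.of_le_sum (s := I)
      (μ := fun A => (surfaceMeasure Ω).restrict (closure (arrangementCell F A))) ?_ ?_
    · intro A hA
      obtain ⟨z, δ, hδ, hδs, hrel⟩ := hconn A hA
      refine PoincareRel.trans (restrict_ball_ne_zero z hδ) ?_ hrel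
      obtain ⟨R, hR, hRs⟩ := hΩ.isBounded.closure.subset_closedBall_lt 0 0
      obtain ⟨M, hM⟩ := surfaceMeasure_closedBall_le hΩ
      refine PoincareRel.of_segments hd hΩ.isOpen measurableSet_ball hR
        ((hδs.trans (hcellΩ A hA)).trans (subset_closure.trans hRs))
        (fun x ρ hρ => (Measure.restrict_apply_le _ _).trans (hM x ρ hρ)) ?_ ?_
      · filter_upwards [ae_restrict_mem isClosed_closure.measurableSet] with x hx
        exact hRs (closure_mono (hcellΩ A hA) hx)
      · filter_upwards [ae_restrict_mem isClosed_closure.measurableSet] with x hx y hy t ht ht1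
        -- A segment from a closure point of a convex set to an interior point enters the interior
        -- at once, so only `x` itself can lie on `Γ`.
        have hy' : y ∈ interior (arrangementCell F A) := by
          rw [(isOpen_arrangementCell F A).interior_eq]; exact hδs hy
        exact hcellΩ A hA (interior_subset ((convex_arrangementCell F A).combo_closure_interior_mem_interior
          hx hy' (by linarith) ht (by ring)))
    · have e : surfaceMeasure Ω = (surfaceMeasure Ω).restrict (frontier Ω) := by
        rw [surfaceMeasure, Measure.restrict_restrict isClosed_frontier.measurableSet,
          Set.inter_self]
      conv_lhs => rw [e]
      exact restrict_le_sum_restrict _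
        (Eventually.of_forall fun x hx => hcl (frontier_subset_closure hx))
  exact hsurf.trans (restrict_ball_ne_zero x₀ hρ) hvol.symm

/-! ### Bessel potentials and Schwartz approximation in Sobolev spaces -/

/-- The Bessel potential of order `τ` of `𝓕⁻ ψ`. -/
noncomputable def besselInv {E : Type*} [NormedAddCommGroup E] [InnerProductSpace ℝ E]
    [FiniteDimensional ℝ E] [MeasurableSpace E] [BorelSpace E] (τ : ℝ) (ψ : 𝓢(E, ℂ)) : 𝓢(E, ℂ) :=
  𝓕⁻ (SchwartzMap.smulLeftCLM ℂ (fun ξ : E => (1 + ‖ξ‖ ^ 2) ^ (-τ / 2)) ψ)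

/-- Up to constants, this bounds the Fourier symbol of one derivative of a Bessel potential; `τ ≥ 1`
is exactly what compensates the growth `‖ξ‖`. -/
theorem norm_mul_one_add_norm_sq_rpow_le {E : Type*} [NormedAddCommGroup E] {τ : ℝ} (hτ : 1 ≤ τ) (ξ : E) :
    ‖ξ‖ * (1 + ‖ξ‖ ^ 2) ^ (-τ / 2) ≤ 1 := by
  have h1 : (1 : ℝ) ≤ 1 + ‖ξ‖ ^ 2 := by nlinarith [sq_nonneg ‖ξ‖]
  have h2 : (1 + ‖ξ‖ ^ 2) ^ (-τ / 2) ≤ (1 + ‖ξ‖ ^ 2) ^ (-(1 / 2) : ℝ) :=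
    Real.rpow_le_rpow_of_exponent_le h1 (by linarith)
  have h3 : ‖ξ‖ ≤ (1 + ‖ξ‖ ^ 2) ^ (1 / 2 : ℝ) := by
    rw [← Real.sqrt_eq_rpow]
    exact Real.le_sqrt_of_sq_le (by linarith)
  calc ‖ξ‖ * (1 + ‖ξ‖ ^ 2) ^ (-τ / 2)
      ≤ (1 + ‖ξ‖ ^ 2) ^ (1 / 2 : ℝ) * (1 + ‖ξ‖ ^ 2) ^ (-(1 / 2) : ℝ) := by gcongr
    _ = 1 := by rw [← Real.rpow_add (by positivity)]; simp

theorem norm_le_sum_norm_apply_basis {E : Type*} [NormedAddCommGroup E] [InnerProductSpace ℝ E]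
    [FiniteDimensional ℝ E] (A : E →L[ℝ] ℂ) :
    ‖A‖ ≤ ∑ i, ‖A (stdOrthonormalBasis ℝ E i)‖ := by
  refine A.opNorm_le_bound (by positivity) fun x => ?_
  conv_lhs => rw [← (stdOrthonormalBasis ℝ E).sum_repr x, map_sum]
  refine (norm_sum_le _ _).trans ?_
  rw [Finset.sum_mul]
  refine Finset.sum_le_sum fun i _ => ?_
  rw [map_smul, norm_smul, mul_comm]
  gcongr
  rw [OrthonormalBasis.repr_apply_apply]
  refine (norm_inner_le_norm _ _).trans ?_
  simp

section Bessel

variable {E : Type*} [NormedAddCommGroup E] [InnerProductSpace ℝ E] [FiniteDimensional ℝ E]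
  [MeasurableSpace E] [BorelSpace E] {τ : ℝ}

theorem besselInv_sub (ψ ψ' : 𝓢(E, ℂ)) :
    besselInv τ (ψ - ψ') = besselInv τ ψ - besselInv τ ψ' := by
  simp only [besselInv, sub_eq_add_neg, map_add, map_neg, FourierTransform.fourierInv_add,
    FourierTransform.fourierInv_neg]

theorem fourier_besselInv_apply (ψ : 𝓢(E, ℂ)) (ξ : E) :
    (𝓕 (besselInv τ ψ)) ξ = (1 + ‖ξ‖ ^ 2) ^ (-τ / 2) • ψ ξ := by
  rw [besselInv, FourierTransform.fourier_fourierInv_eq]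
  exact SchwartzMap.smulLeftCLM_apply_apply (by fun_prop) _ _

/-- The square of the weight decays like `‖ξ‖ ^ (-2 τ)`, integrable because `2 τ > dim E`. -/
theorem memLp_one_add_norm_sq_rpow (hτ : (Module.finrank ℝ E : ℝ) / 2 < τ) :
    MemLp (fun ξ : E => (1 + ‖ξ‖ ^ 2) ^ (-τ / 2)) 2 := by
  have hc : Continuous fun ξ : E => (1 + ‖ξ‖ ^ 2) ^ (-τ / 2) :=
    Continuous.rpow_const (by fun_prop) fun ξ => Or.inl (by positivity)
  rw [memLp_two_iff_integrable_sq hc.aestronglyMeasurable]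
  have h := integrable_rpow_neg_one_add_norm_sq (E := E) (μ := volume) (r := 2 * τ)
    (by linarith)
  refine h.congr (Eventually.of_forall fun ξ => ?_)
  simp only
  rw [← Real.rpow_mul_natCast (by positivity)]
  congr 1
  push_cast
  ring

/-- Sobolev embedding into bounded functions: the sup norm is at most the `L¹` norm on the Fourier
side, which Cauchy–Schwarz splits into the `L²` norms of the weight and of `ψ`. -/
theorem exists_norm_besselInv_le (hτ : (Module.finrank ℝ E : ℝ) / 2 < τ) :
    ∃ A : ℝ, ∀ (ψ : 𝓢(E, ℂ)) (x : E), ‖besselInv τ ψ x‖ ≤ A * ‖ψ.toLp 2 volume‖ := by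
  have hm := memLp_one_add_norm_sq_rpow (E := E) hτ
  refine ⟨(eLpNorm (fun ξ : E => (1 + ‖ξ‖ ^ 2) ^ (-τ / 2)) 2 volume).toReal, fun ψ x => ?_⟩
  rw [besselInv, SchwartzMap.fourierInv_apply_eq]
  refine (SchwartzMap.norm_fourier_apply_le_toLp_one _ (-x)).trans ?_
  rw [SchwartzMap.norm_toLp, SchwartzMap.norm_toLp, ← ENNReal.toReal_mul]
  refine ENNReal.toReal_mono (ENNReal.mul_ne_top hm.eLpNorm_ne_top (ψ.memLp 2 volume).eLpNorm_ne_top) ?_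
  rw [SchwartzMap.smulLeftCLM_apply (by fun_prop)]
  exact eLpNorm_smul_le_mul_eLpNorm (p := 2) (q := 2) (r := 1) (ψ.memLp 2 volume).1 hm.1

/-- By Plancherel the derivative becomes multiplication by `2πi⟨ξ, m⟩`, which the Bessel weight
keeps bounded. -/
theorem norm_lineDeriv_besselInv_le (hτ : 1 ≤ τ) (ψ : 𝓢(E, ℂ)) (m : E) :
    ‖(∂_{m} (besselInv τ ψ) : 𝓢(E, ℂ)).toLp 2 volume‖ ≤ 2 * Real.pi * ‖m‖ * ‖ψ.toLp 2 volume‖ := by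
  rw [← SchwartzMap.norm_fourier_toL2_eq, SchwartzMap.fourier_lineDerivOp_eq,
    SchwartzMap.norm_toLp, SchwartzMap.norm_toLp]
  have h : eLpNorm (((2 * Real.pi * Complex.I) • SchwartzMap.smulLeftCLM ℂ (inner ℝ · m)
      (𝓕 (besselInv τ ψ)) : 𝓢(E, ℂ))) 2 volume ≤
      ENNReal.ofReal (2 * Real.pi * ‖m‖) * eLpNorm ψ 2 volume := by
    refine eLpNorm_le_mul_eLpNorm_of_ae_le_mul (Eventually.of_forall fun ξ => ?_) 2
    have htg : (inner ℝ · m : E → ℝ).HasTemperateGrowth :=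
      ((innerSL ℝ).flip m).hasTemperateGrowth
    rw [smul_apply, SchwartzMap.smulLeftCLM_apply_apply htg, fourier_besselInv_apply]
    simp only [norm_smul, norm_mul, Complex.norm_I, mul_one]
    have h1 : ‖(inner ℝ ξ m : ℝ)‖ ≤ ‖ξ‖ * ‖m‖ := norm_inner_le_norm ξ m
    have h2 := norm_mul_one_add_norm_sq_rpow_le hτ ξ
    rw [Real.norm_of_nonneg (show (0:ℝ) ≤ (1 + ‖ξ‖ ^ 2) ^ (-τ / 2) by positivity)]
    have h3 : ‖(2 : ℂ)‖ * ‖(Real.pi : ℂ)‖ = 2 * Real.pi := by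
      simp [abs_of_pos Real.pi_pos]
    rw [h3]
    calc 2 * Real.pi * (‖(inner ℝ ξ m : ℝ)‖ * ((1 + ‖ξ‖ ^ 2) ^ (-τ / 2) * ‖ψ ξ‖))
        ≤ 2 * Real.pi * ((‖ξ‖ * ‖m‖) * ((1 + ‖ξ‖ ^ 2) ^ (-τ / 2) * ‖ψ ξ‖)) := by gcongr
      _ = 2 * Real.pi * ‖m‖ * (‖ξ‖ * (1 + ‖ξ‖ ^ 2) ^ (-τ / 2)) * ‖ψ ξ‖ := by ring
      _ ≤ 2 * Real.pi * ‖m‖ * 1 * ‖ψ ξ‖ := by gcongr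
      _ = _ := by ring
  have h2 := ENNReal.toReal_mono (ENNReal.mul_ne_top (by simp) (ψ.memLp 2 volume).eLpNorm_ne_top) h
  rwa [ENNReal.toReal_mul, ENNReal.toReal_ofReal (by positivity)] at h2

theorem norm_fderiv_besselInv_le (hτ : 1 ≤ τ) (ψ : 𝓢(E, ℂ)) :
    ‖(SchwartzMap.fderivCLM ℝ (E) ℂ (besselInv τ ψ)).toLp 2 volume‖ ≤
      Module.finrank ℝ E * (2 * Real.pi) * ‖ψ.toLp 2 volume‖ := by
  set b := stdOrthonormalBasis ℝ E
  have h : ‖(SchwartzMap.fderivCLM ℝ (E) ℂ (besselInv τ ψ)).toLp 2 volume‖ ≤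
      ∑ i, ‖(∂_{b i} (besselInv τ ψ) : 𝓢(E, ℂ)).toLp 2 volume‖ := by
    simp only [SchwartzMap.norm_toLp]
    rw [← ENNReal.toReal_sum fun i _ => (SchwartzMap.memLp _ 2 volume).eLpNorm_ne_top]
    refine ENNReal.toReal_mono
      (ENNReal.sum_ne_top.2 fun i _ => (SchwartzMap.memLp _ 2 volume).eLpNorm_ne_top) ?_
    calc _ ≤ eLpNorm (∑ i, fun x => ‖(∂_{b i} (besselInv τ ψ) : 𝓢(E, ℂ)) x‖) 2 volume := by
          refine eLpNorm_mono_real fun x => ?_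
          rw [Finset.sum_apply]
          exact norm_le_sum_norm_apply_basis _
      _ ≤ ∑ i, eLpNorm (fun x => ‖(∂_{b i} (besselInv τ ψ) : 𝓢(E, ℂ)) x‖) 2 volume :=
          eLpNorm_sum_le (fun i _ => (SchwartzMap.continuous _).norm.aestronglyMeasurable)
            (by norm_num)
      _ = _ := by simp only [eLpNorm_norm]
  refine h.trans ((Finset.sum_le_sum fun i _ => norm_lineDeriv_besselInv_le hτ ψ (b i)).trans ?_)
  simp [b, mul_assoc]

end Bessel

theorem cauchySeq_of_dist_le_mul {α β : Type*} [PseudoMetricSpace α] [PseudoMetricSpace β]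
    {u : ℕ → α} {v : ℕ → β} (hv : CauchySeq v) (K : ℝ)
    (h : ∀ m n, dist (u m) (u n) ≤ K * dist (v m) (v n)) : CauchySeq u := by
  rw [cauchySeq_iff_tendsto_dist_atTop_0] at hv ⊢
  have h2 := hv.const_mul K
  rw [mul_zero] at h2
  exact squeeze_zero (fun _ => dist_nonneg) (fun p => h p.1 p.2) h2

section BesselApproximation

variable {E : Type*} [NormedAddCommGroup E] [InnerProductSpace ℝ E] [FiniteDimensional ℝ E]
  [MeasurableSpace E] [BorelSpace E] {τ : ℝ}

/-- On the Fourier side the left difference is the right one multiplied by `(1 + ‖ξ‖²) ^ (-τ / 2) ≤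
1`. -/
theorem norm_toLp_besselInv_sub_le (hτ : 0 ≤ τ) (f : Lp ℂ 2 (volume : Measure E))
    (hF : MemLp (fun ξ => (1 + ‖ξ‖ ^ 2) ^ (τ / 2) • (𝓕 f : Lp ℂ 2 (volume : Measure E)) ξ) 2 volume)
    (ψ : 𝓢(E, ℂ)) :
    ‖(besselInv τ ψ).toLp 2 volume - f‖ ≤ ‖ψ.toLp 2 volume - hF.toLp _‖ := by
  rw [← Lp.norm_fourier_eq, sub_eq_add_neg, FourierTransform.fourier_add,
    FourierTransform.fourier_neg, SchwartzMap.toLp_fourier_eq, ← sub_eq_add_neg]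
  refine Lp.norm_le_norm_of_ae_le ?_
  filter_upwards [Lp.coeFn_sub ((𝓕 (besselInv τ ψ)).toLp 2 volume) (𝓕 f),
    Lp.coeFn_sub (ψ.toLp 2 volume) (hF.toLp _), hF.coeFn_toLp,
    (𝓕 (besselInv τ ψ)).coeFn_toLp 2 volume, ψ.coeFn_toLp 2 volume] with ξ h1 h2 h3 h4 h5
  rw [h1, h2, Pi.sub_apply, Pi.sub_apply, h3, h4, h5, fourier_besselInv_apply]
  have h6 : (1 : ℝ) ≤ 1 + ‖ξ‖ ^ 2 := by nlinarith [sq_nonneg ‖ξ‖]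
  have h7 : (1 + ‖ξ‖ ^ 2) ^ (-τ / 2) * (1 + ‖ξ‖ ^ 2) ^ (τ / 2) = 1 := by
    rw [← Real.rpow_add (by positivity), neg_div, neg_add_cancel, Real.rpow_zero]
  set a := (𝓕 f : Lp ℂ 2 (volume : Measure E)) ξ
  have h8 : (1 + ‖ξ‖ ^ 2) ^ (-τ / 2) • ψ ξ - a =
      (1 + ‖ξ‖ ^ 2) ^ (-τ / 2) • (ψ ξ - (1 + ‖ξ‖ ^ 2) ^ (τ / 2) • a) := by
    rw [smul_sub, smul_smul, h7, one_smul]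
  rw [h8, norm_smul, Real.norm_of_nonneg (by positivity)]
  exact mul_le_of_le_one_left (norm_nonneg _) (Real.rpow_le_one_of_one_le_of_nonpos h6 (by linarith))

/-- A continuous function in a Sobolev space `H^τ`, `τ > dim E / 2`, `τ ≥ 1`, is a limit of
Schwartz functions, uniformly and in `H¹`. -/
theorem exists_schwartz_approximation (hτ : (Module.finrank ℝ E : ℝ) / 2 < τ) (hτ1 : 1 ≤ τ)
    (f : Lp ℂ 2 (volume : Measure E))
    (hF : MemLp (fun ξ => (1 + ‖ξ‖ ^ 2) ^ (τ / 2) • (𝓕 f : Lp ℂ 2 (volume : Measure E)) ξ) 2 volume)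
    {Φ : E → ℂ} (hΦ : Continuous Φ) (hfΦ : f =ᵐ[volume] Φ) :
    ∃ (u : ℕ → 𝓢(E, ℂ)) (G : E → (E →L[ℝ] ℂ)),
      TendstoUniformly (fun n x => u n x) Φ atTop ∧ MemLp G 2 volume ∧
      Tendsto (fun n => eLpNorm (fun x => fderiv ℝ (u n) x - G x) 2 volume) atTop (𝓝 0) := by
  -- Schwartz functions `ψ n` approximate the weighted transform of `f` in `L²`. Their images under
  -- `besselInv` are the approximants of `f`, and the preceding bounds make them Cauchy both
  -- uniformly and in `H¹`.
  obtain ⟨s, hs, hlim⟩ := mem_closure_iff_seq_limit.1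
    (SchwartzMap.denseRange_toLpCLM (E := E) (F := ℂ) (μ := volume) (p := 2)
      ENNReal.ofNat_ne_top (hF.toLp _))
  choose ψ hψ using hs
  simp only [SchwartzMap.toLpCLM_apply] at hψ
  have hψlim : Tendsto (fun n => (ψ n).toLp 2 volume) atTop (𝓝 (hF.toLp _)) := by
    simpa only [hψ] using hlim
  have hψc := hψlim.cauchySeq
  have hψsub : ∀ m n, (ψ m - ψ n).toLp 2 volume = (ψ m).toLp 2 volume - (ψ n).toLp 2 volume :=
    fun m n => map_sub (SchwartzMap.toLpCLM ℝ ℂ 2 (volume : Measure E)) (ψ m) (ψ n)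
  obtain ⟨A, hA⟩ := exists_norm_besselInv_le hτ
  have hA0 : 0 ≤ max A 0 := le_max_right _ _
  have hUc : CauchySeq fun n => (besselInv τ (ψ n)).toBoundedContinuousFunction := by
    refine cauchySeq_of_dist_le_mul hψc (max A 0) fun m n => ?_
    rw [BoundedContinuousFunction.dist_le (by positivity)]
    intro x
    rw [SchwartzMap.toBoundedContinuousFunction_apply, SchwartzMap.toBoundedContinuousFunction_apply,
      dist_eq_norm, dist_eq_norm, ← hψsub, ← sub_apply, ← besselInv_sub]
    exact (hA _ x).trans (mul_le_mul_of_nonneg_right (le_max_left _ _) (norm_nonneg _))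
  obtain ⟨U, hU⟩ := cauchySeq_tendsto_of_complete hUc
  have hUu := BoundedContinuousFunction.tendsto_iff_tendstoUniformly.1 hU
  have hDc : CauchySeq fun n =>
      (SchwartzMap.fderivCLM ℝ E ℂ (besselInv τ (ψ n))).toLp 2 volume := by
    refine cauchySeq_of_dist_le_mul hψc (Module.finrank ℝ E * (2 * Real.pi)) fun m n => ?_
    rw [dist_eq_norm, dist_eq_norm, ← hψsub]
    have e : (SchwartzMap.fderivCLM ℝ E ℂ (besselInv τ (ψ m))).toLp 2 volume -
        (SchwartzMap.fderivCLM ℝ E ℂ (besselInv τ (ψ n))).toLp 2 volume =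
        (SchwartzMap.fderivCLM ℝ E ℂ (besselInv τ (ψ m - ψ n))).toLp 2 volume := by
      rw [besselInv_sub, map_sub]
      exact (map_sub (SchwartzMap.toLpCLM ℝ (E →L[ℝ] ℂ) 2 (volume : Measure E)) _ _).symm
    rw [e]
    exact norm_fderiv_besselInv_le hτ1 _
  obtain ⟨G, hG⟩ := cauchySeq_tendsto_of_complete hDc
  have hfl : Tendsto (fun n => (besselInv τ (ψ n)).toLp 2 volume) atTop (𝓝 f) := by
    rw [tendsto_iff_norm_sub_tendsto_zero] at hψlim ⊢
    exact squeeze_zero (fun _ => norm_nonneg _)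
      (fun n => norm_toLp_besselInv_sub_le (by linarith) f hF (ψ n)) hψlim
  -- The uniform limit agrees almost everywhere with the `L²` limit along a subsequence; continuity
  -- upgrades this to equality everywhere.
  have hUΦ : (U : E → ℂ) = Φ := by
    obtain ⟨ns, hns, hae⟩ := (tendstoInMeasure_of_tendsto_Lp hfl).exists_seq_tendsto_ae
    refine (Continuous.ae_eq_iff_eq volume U.continuous hΦ).1 ?_
    have hall : ∀ᵐ x : E, ∀ n, (besselInv τ (ψ n)).toLp 2 volume x = besselInv τ (ψ n) x :=
      ae_all_iff.2 fun n => (besselInv τ (ψ n)).coeFn_toLp 2 volume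
    filter_upwards [hae, hall, hfΦ] with x h1 h2 h3
    simp only [h2] at h1
    rw [← h3]
    exact tendsto_nhds_unique ((hUu.tendsto_at x).comp hns.tendsto_atTop) h1
  refine ⟨fun n => besselInv τ (ψ n), G, hUΦ ▸ hUu, Lp.memLp G, ?_⟩
  rw [Lp.tendsto_Lp_iff_tendsto_eLpNorm'] at hG
  refine hG.congr fun n => eLpNorm_congr_ae ?_
  filter_upwards [(SchwartzMap.fderivCLM ℝ E ℂ (besselInv τ (ψ n))).coeFn_toLp 2 volume] with x hx
  rw [Pi.sub_apply, hx, SchwartzMap.fderivCLM_apply]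

end BesselApproximation

/-! ### Functions approximable by `C¹` functions uniformly and in `H¹` -/

theorem memLp_two_add {α F : Type*} [MeasurableSpace α] [NormedAddCommGroup F] {μ : Measure α}
    {f g : α → F} (hf : MemLp f 2 μ) (hg : MemLp g 2 μ) : MemLp (f + g) 2 μ :=
  hf.add hg

theorem eLpNorm_two_add_le {α F : Type*} [MeasurableSpace α] [NormedAddCommGroup F] {μ : Measure α}
    {f g : α → F} (hf : AEStronglyMeasurable f μ) (hg : AEStronglyMeasurable g μ) :
    eLpNorm (f + g) 2 μ ≤ eLpNorm f 2 μ + eLpNorm g 2 μ :=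
  eLpNorm_add_le hf hg one_le_two

/-- `v` is a limit of `C¹` functions, uniformly and in `H¹(ℝ^d)`. -/
def IsH1Limit {d : ℕ} (v : Space d → ℝ) : Prop :=
  ∃ (w : ℕ → Space d → ℝ) (G : Space d → (Space d →L[ℝ] ℝ)), (∀ n, ContDiff ℝ 1 (w n)) ∧
    TendstoUniformly w v atTop ∧ MemLp G 2 volume ∧
    Tendsto (fun n => eLpNorm (fun x => fderiv ℝ (w n) x - G x) 2 volume) atTop (𝓝 0)

/-- The upper bound on the transform dominates its product with `(1 + ‖ξ‖²) ^ (τ / 2)` by `C (1 +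
‖ξ‖²) ^ (-τ / 2)`, which is in `L²`. The lower bound only supplies the sign of `g`. -/
theorem IsRadialBasisFunction.isH1Limit {d : ℕ} (hd : 2 ≤ d) {τ : ℝ} (hτ : (d : ℝ) / 2 < τ)
    {Φ : Space d → ℝ} (hΦ : IsRadialBasisFunction τ Φ) : IsH1Limit Φ := by
  have hd' : (2 : ℝ) ≤ d := by exact_mod_cast hd
  have hτ1 : 1 ≤ τ := by linarith
  obtain ⟨h, g, c, C, hc, hC, hg, hb⟩ := hΦ.fourier
  set f := h.toLp (fun x => (Φ x : ℂ)) with hf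
  have hτ' : (Module.finrank ℝ (Space d) : ℝ) / 2 < τ := by
    rwa [finrank_euclideanSpace_fin]
  have hF : MemLp (fun ξ => (1 + ‖ξ‖ ^ 2) ^ (τ / 2) •
      (𝓕 f : Lp ℂ 2 (volume : Measure (Space d))) ξ) 2 volume := by
    have hm := (memLp_one_add_norm_sq_rpow hτ').const_mul C
    have hcont : Continuous fun ξ : Space d => (1 + ‖ξ‖ ^ 2) ^ (τ / 2) :=
      Continuous.rpow_const (by fun_prop) fun ξ => Or.inl (by positivity)
    refine hm.mono (hcont.aestronglyMeasurable.smul (Lp.aestronglyMeasurable _)) ?_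
    filter_upwards [hg, hb] with ξ h1 h2
    rw [h1, norm_smul, Complex.norm_real, Real.norm_of_nonneg (by positivity)]
    have h3 : 0 ≤ g ξ := le_trans (by positivity) h2.1
    rw [Real.norm_of_nonneg h3, Real.norm_of_nonneg (by positivity)]
    calc (1 + ‖ξ‖ ^ 2) ^ (τ / 2) * g ξ
        ≤ (1 + ‖ξ‖ ^ 2) ^ (τ / 2) * (C * (1 + ‖ξ‖ ^ 2) ^ (-τ)) := by gcongr; exact h2.2
      _ = C * ((1 + ‖ξ‖ ^ 2) ^ (τ / 2) * (1 + ‖ξ‖ ^ 2) ^ (-τ)) := by ring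
      _ = _ := by
          rw [← Real.rpow_add (by positivity)]
          congr 2
          ring
  obtain ⟨u, G, hu, hG, hlim⟩ := exists_schwartz_approximation hτ' hτ1 f hF
    (Complex.continuous_ofReal.comp hΦ.continuous) h.coeFn_toLp
  have hd1 : ∀ n x, HasFDerivAt (fun x => (u n x).re)
      (Complex.reCLM.comp (fderiv ℝ (u n) x)) x := fun n x =>
    Complex.reCLM.hasFDerivAt.comp x (u n).differentiableAt.hasFDerivAt
  refine ⟨fun n x => (u n x).re, fun x => Complex.reCLM.comp (G x), fun n => ?_, ?_, ?_, ?_⟩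
  · exact Complex.reCLM.contDiff.comp ((u n).smooth 1)
  · simpa using! Complex.reCLM.uniformContinuous.comp_tendstoUniformly hu
  · have := (ContinuousLinearMap.compL ℝ (Space d) ℂ ℝ Complex.reCLM).comp_memLp' hG
    exact this
  · refine tendsto_of_tendsto_of_tendsto_of_le_of_le tendsto_const_nhds hlim
      (fun _ => zero_le) fun n => ?_
    refine eLpNorm_mono fun x => ?_
    rw [(hd1 n x).fderiv, ← ContinuousLinearMap.comp_sub]
    refine (ContinuousLinearMap.opNorm_comp_le _ _).trans ?_
    rw [Complex.reCLM_norm, one_mul]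

theorem IsH1Limit.add {d : ℕ} {v v' : Space d → ℝ} (h : IsH1Limit v) (h' : IsH1Limit v') :
    IsH1Limit (v + v') := by
  obtain ⟨w, G, hw, hu, hG, hlim⟩ := h
  obtain ⟨w', G', hw', hu', hG', hlim'⟩ := h'
  have hu2 : TendstoUniformly (fun n => w n + w' n) (v + v') atTop := hu.add hu'
  have hG2 : MemLp (G + G') 2 volume :=
    memLp_two_add hG hG'
  refine ⟨fun n => w n + w' n, G + G', fun n => (hw n).add (hw' n), hu2, hG2, ?_⟩
  have hsum := hlim.add hlim'
  rw [add_zero] at hsum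
  refine tendsto_of_tendsto_of_tendsto_of_le_of_le tendsto_const_nhds hsum
      (fun _ => zero_le) fun n => ?_
  have hm : ∀ n, AEStronglyMeasurable (fun x => fderiv ℝ (w n) x - G x) volume := fun n =>
    ((hw n).continuous_fderiv (by norm_num)).aestronglyMeasurable.sub hG.1
  have hm' : ∀ n, AEStronglyMeasurable (fun x => fderiv ℝ (w' n) x - G' x) volume := fun n =>
    ((hw' n).continuous_fderiv (by norm_num)).aestronglyMeasurable.sub hG'.1
  have e : (fun x => fderiv ℝ (w n + w' n) x - (G + G') x) =
      (fun x => fderiv ℝ (w n) x - G x) + fun x => fderiv ℝ (w' n) x - G' x := by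
    ext1 x
    rw [fderiv_add ((hw n).differentiable (by norm_num) x)
      ((hw' n).differentiable (by norm_num) x)]
    simp only [Pi.add_apply]
    abel
  rw [e]
  exact eLpNorm_two_add_le (hm n) (hm' n)

theorem IsH1Limit.const_smul {d : ℕ} {v : Space d → ℝ} (h : IsH1Limit v) (c : ℝ) :
    IsH1Limit (c • v) := by
  obtain ⟨w, G, hw, hu, hG, hlim⟩ := h
  refine ⟨fun n => c • w n, c • G, fun n => contDiff_const.smul (hw n), ?_, hG.const_smul c, ?_⟩
  · exact (uniformContinuous_const_smul c).comp_tendstoUniformly hu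
  · have h2 := ENNReal.Tendsto.const_mul (a := ‖c‖ₑ) hlim (Or.inr enorm_ne_top)
    rw [mul_zero] at h2
    refine h2.congr fun n => ?_
    rw [← eLpNorm_const_smul]
    congr 1
    ext1 x
    rw [fderiv_const_smul ((hw n).differentiable (by norm_num) x)]
    simp only [Pi.smul_apply, smul_sub]

/-- The affine substitution multiplies Lebesgue measure by a finite constant and gradients by `a`,
so `L²` convergence survives. -/
theorem IsH1Limit.comp_smul_sub {d : ℕ} {v : Space d → ℝ} (h : IsH1Limit v) {a : ℝ} (ha : 0 < a)
    (y : Space d) : IsH1Limit fun x => v (a • (x - y)) := by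
  obtain ⟨w, G, hw, hu, hG, hlim⟩ := h
  have hmT : Measurable fun x : Space d => a • (x - y) := by fun_prop
  set K := ENNReal.ofReal |(a ^ Module.finrank ℝ (Space d))⁻¹| with hK
  have hmap : Measure.map (fun x : Space d => a • (x - y)) volume = K • volume := by
    rw [← Measure.map_addHaar_smul volume ha.ne']
    conv_rhs => rw [← (measurePreserving_sub_right volume y).map_eq]
    rw [Measure.map_map (by fun_prop) (by fun_prop)]
    rfl
  have hfd : ∀ n x, fderiv ℝ (fun x => w n (a • (x - y))) x = a • fderiv ℝ (w n) (a • (x - y)) := by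
    intro n x
    have h1 : HasFDerivAt (fun x : Space d => a • (x - y)) (a • ContinuousLinearMap.id ℝ _) x :=
      ((hasFDerivAt_id x).sub_const y).const_smul a
    have h2 := ((hw n).differentiable (by norm_num) (a • (x - y))).hasFDerivAt.comp x h1
    refine h2.fderiv.trans ?_
    ext z
    simp
  refine ⟨fun n x => w n (a • (x - y)), fun x => a • G (a • (x - y)),
    fun n => (hw n).comp (by fun_prop), hu.comp _, ?_, ?_⟩
  · refine MemLp.const_smul (f := fun x => G (a • (x - y))) ?_ a
    have h1 : MemLp G 2 (Measure.map (fun x : Space d => a • (x - y)) volume) := by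
      rw [hmap]; exact hG.smul_measure ENNReal.ofReal_ne_top
    exact h1.comp_of_map hmT.aemeasurable
  · have hD : ∀ n, AEStronglyMeasurable (fun x => fderiv ℝ (w n) x - G x) volume := fun n =>
      ((hw n).continuous_fderiv (by norm_num)).aestronglyMeasurable.sub hG.1
    have e : ∀ n, eLpNorm (fun x => fderiv ℝ (fun x => w n (a • (x - y))) x - a • G (a • (x - y)))
        2 volume = ‖a‖ₑ * (K ^ (1 / (2 : ℝ≥0∞)).toReal *
          eLpNorm (fun x => fderiv ℝ (w n) x - G x) 2 volume) := by
      intro n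
      have h3 : AEStronglyMeasurable (fun x => fderiv ℝ (w n) x - G x)
          (Measure.map (fun x : Space d => a • (x - y)) volume) := by
        rw [hmap]; exact (hD n).smul_measure K
      rw [← smul_eq_mul (K ^ _), ← eLpNorm_smul_measure_of_ne_top (by norm_num), ← hmap,
        eLpNorm_map_measure h3 hmT.aemeasurable, ← eLpNorm_const_smul]
      congr 1
      ext1 x
      rw [hfd]
      simp only [Pi.smul_apply, Function.comp_apply, smul_sub]
    simp only [e]
    have h4 := ENNReal.Tendsto.const_mul (a := K ^ (1 / (2 : ℝ≥0∞)).toReal) hlim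
      (Or.inr (ENNReal.rpow_ne_top_of_nonneg (by positivity) ENNReal.ofReal_ne_top))
    have h5 := ENNReal.Tendsto.const_mul (a := ‖a‖ₑ) h4 (Or.inr enorm_ne_top)
    simpa using h5

theorem IsH1Limit.of_mem_rbfSpace {d : ℕ} {Φ : Space d → ℝ} (hΦ : IsH1Limit Φ) {r : ℝ} (hr : 0 < r)
    {X : Finset (Space d)} {v : Space d → ℝ} (hv : v ∈ rbfSpace Φ r X) : IsH1Limit v := by
  induction hv using Submodule.span_induction with
  | mem u hu =>
    obtain ⟨y, -, rfl⟩ := hu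
    exact (hΦ.comp_smul_sub (inv_pos.2 hr) y).const_smul ((r ^ d)⁻¹)
  | zero => simpa using hΦ.const_smul 0
  | add u u' _ _ h h' => exact h.add h'
  | smul c u _ h => exact h.const_smul c

/-! ### Weak gradients -/

theorem setIntegral_eq_integral_of_tsupport_subset {d : ℕ} {F : Type*} [NormedAddCommGroup F]
    [NormedSpace ℝ F] {Ω : Set (Space d)} {φ : Space d → ℝ} (hφ : tsupport φ ⊆ Ω)
    {f : Space d → F} (hf : ∀ x, x ∉ tsupport φ → f x = 0) : ∫ x in Ω, f x = ∫ x, f x :=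
  setIntegral_eq_integral_of_forall_compl_eq_zero fun x hx => hf x fun h => hx (hφ h)

theorem fderiv_apply_eq_zero_of_notMem_tsupport {d : ℕ} {φ : Space d → ℝ} {x : Space d}
    (hx : x ∉ tsupport φ) (e : Space d) : fderiv ℝ φ x e = 0 := by
  have : fderiv ℝ φ x = 0 := by
    by_contra h
    exact hx (support_fderiv_subset ℝ h)
  rw [this]; rfl

/-- Fundamental lemma of the calculus of variations. It permits computing with any explicit gradient
in place of the one chosen in `weakGradient`. -/
theorem IsWeakGradient.ae_eq {d : ℕ} {Ω : Set (Space d)} (hΩ : IsOpen Ω)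
    (hb : Bornology.IsBounded Ω) {v : Space d → ℝ} {g g' : Space d → Space d}
    (h : IsWeakGradient Ω v g) (h' : IsWeakGradient Ω v g') :
    g =ᵐ[volume.restrict Ω] g' := by
  have := isFiniteMeasure_restrict_of_isBounded hb
  have hi : Integrable (fun x => g x - g' x) (volume.restrict Ω) :=
    (h.1.sub h'.1).integrable one_le_two
  have key := hΩ.ae_eq_zero_of_integral_contDiff_smul_eq_zero (μ := volume)
    (f := fun x => g x - g' x) (IntegrableOn.locallyIntegrableOn hi) ?_
  · have := (ae_restrict_iff' hΩ.measurableSet).2 key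
    filter_upwards [this] with x hx using sub_eq_zero.1 hx
  · intro φ hφ hφc hφs
    have hφm : MemLp φ 2 (volume.restrict Ω) :=
      (hφ.continuous.memLp_of_hasCompactSupport hφc).restrict Ω
    rw [← setIntegral_eq_integral_of_tsupport_subset hφs
      (f := fun x => φ x • (g x - g' x)) fun x hx => by simp [image_eq_zero_of_notMem_tsupport hx]]
    have hint : ∀ {u : Space d → Space d}, MemLp u 2 (volume.restrict Ω) →
        ∀ e, Integrable (fun x => ⟪u x, e⟫_ℝ * φ x) (volume.restrict Ω) := fun hu e =>
      (hu.inner_const e).integrable_mul hφm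
    have hs : Integrable (fun x => φ x • (g x - g' x)) (volume.restrict Ω) :=
      memLp_one_iff_integrable.1 (MemLp.smul (p := 2) (q := 2) (r := 1) (h.1.sub h'.1) hφm)
    refine ext_inner_right ℝ fun e => ?_
    rw [inner_zero_left, real_inner_comm, ← integral_inner hs]
    have e1 : ∀ x, ⟪e, φ x • (g x - g' x)⟫_ℝ = ⟪g x, e⟫_ℝ * φ x - ⟪g' x, e⟫_ℝ * φ x := by
      intro x
      rw [inner_smul_right, inner_sub_right, real_inner_comm (g x), real_inner_comm (g' x)]
      ring
    simp only [e1]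
    rw [integral_sub (hint h.1 e) (hint h'.1 e)]
    have h1 := h.2 φ hφ hφc hφs e
    have h2 := h'.2 φ hφ hφc hφs e
    linarith

/-- Integrate `w n` by parts against the test function and pass to the limit, using uniform
convergence on one side and `L²` convergence of gradients on the other. -/
theorem isWeakGradient_of_tendsto {d : ℕ} (Ω : Set (Space d)) {v : Space d → ℝ}
    {w : ℕ → Space d → ℝ} {G : Space d → (Space d →L[ℝ] ℝ)} (hw : ∀ n, ContDiff ℝ 1 (w n))
    (hu : TendstoUniformly w v atTop) (hG : MemLp G 2 volume)
    (hlim : Tendsto (fun n => eLpNorm (fun x => fderiv ℝ (w n) x - G x) 2 volume) atTop (𝓝 0)) :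
    IsWeakGradient Ω v fun x => (InnerProductSpace.toDual ℝ (Space d)).symm (G x) := by
  have hvc : Continuous v := hu.continuous (Frequently.of_forall fun n => (hw n).continuous)
  constructor
  · refine MemLp.restrict Ω (hG.of_le ?_ (Eventually.of_forall fun x => ?_))
    · exact (InnerProductSpace.toDual ℝ (Space d)).symm.continuous.comp_aestronglyMeasurable hG.1
    · rw [LinearIsometryEquiv.norm_map]
  intro φ hφ hφc hφs e
  simp only [InnerProductSpace.toDual_symm_apply]
  rw [setIntegral_eq_integral_of_tsupport_subset hφs
      (f := fun x => v x * fderiv ℝ φ x e)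
      fun x hx => by simp [fderiv_apply_eq_zero_of_notMem_tsupport hx],
    setIntegral_eq_integral_of_tsupport_subset hφs (f := fun x => G x e * φ x)
      fun x hx => by simp [image_eq_zero_of_notMem_tsupport hx]]
  have hdφ : Continuous fun x => fderiv ℝ φ x e :=
    (hφ.continuous_fderiv (by simp)).clm_apply continuous_const
  have hdφc : HasCompactSupport fun x => fderiv ℝ φ x e := hφc.fderiv_apply (𝕜 := ℝ) e
  have hφm : MemLp φ 2 volume := hφ.continuous.memLp_of_hasCompactSupport hφc
  have hdw : ∀ n, Continuous fun x => fderiv ℝ (w n) x e := fun n =>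
    ((hw n).continuous_fderiv (by norm_num)).clm_apply continuous_const
  have hint : ∀ n, Integrable fun x => fderiv ℝ (w n) x e * φ x := fun n =>
    ((hdw n).mul hφ.continuous).integrable_of_hasCompactSupport hφc.mul_left
  have hparts : ∀ n, ∫ x, w n x * fderiv ℝ φ x e = - ∫ x, fderiv ℝ (w n) x e * φ x := by
    intro n
    refine integral_mul_fderiv_eq_neg_fderiv_mul_of_integrable (hint n) ?_ ?_
      (fun x _ => (hw n).differentiable (by norm_num) x) (fun x _ => hφ.differentiable (by simp) x)
    · exact ((hw n).continuous.mul hdφ).integrable_of_hasCompactSupport hdφc.mul_left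
    · exact ((hw n).continuous.mul hφ.continuous).integrable_of_hasCompactSupport hφc.mul_left
  have hl : Tendsto (fun n => ∫ x, w n x * fderiv ℝ φ x e) atTop
      (𝓝 (∫ x, v x * fderiv ℝ φ x e)) := by
    -- Eventually `w n` is within 1 of `v` everywhere, which gives the majorant; compact support
    -- makes it integrable.
    refine tendsto_integral_filter_of_dominated_convergence
      (fun x => ‖(|v x| + 1) * fderiv ℝ φ x e‖)
      (Eventually.of_forall fun n => ((hw n).continuous.mul hdφ).aestronglyMeasurable) ?_ ?_ ?_
    · filter_upwards [Metric.tendstoUniformly_iff.1 hu 1 one_pos] with n hn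
      refine Eventually.of_forall fun x => ?_
      rw [norm_mul, norm_mul]
      refine mul_le_mul_of_nonneg_right ?_ (norm_nonneg _)
      have h1 := hn x
      rw [Real.dist_eq, abs_sub_comm] at h1
      rw [Real.norm_eq_abs, Real.norm_of_nonneg (by positivity)]
      linarith [abs_sub_abs_le_abs_sub (w n x) (v x)]
    · have hc : Continuous fun x => (|v x| + 1) * fderiv ℝ φ x e := by fun_prop
      exact (hc.integrable_of_hasCompactSupport hdφc.mul_left).norm
    · exact Eventually.of_forall fun x => (hu.tendsto_at x).mul_const _
  have hGe : MemLp (fun x => G x e) 2 volume := by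
    refine MemLp.of_le (f := fun x => G x e) (hG.norm.const_mul ‖e‖)
      ((ContinuousLinearMap.apply ℝ ℝ e).continuous.comp_aestronglyMeasurable hG.1)
      (Eventually.of_forall fun x => ?_)
    rw [norm_mul, norm_norm, norm_norm, mul_comm]
    exact (G x).le_opNorm e
  have hr : Tendsto (fun n => ∫ x, fderiv ℝ (w n) x e * φ x) atTop (𝓝 (∫ x, G x e * φ x)) := by
    refine tendsto_integral_of_L1' _ (hGe.integrable_mul hφm).aestronglyMeasurable
      (Eventually.of_forall hint) ?_
    have h0 := ENNReal.Tendsto.const_mul (a := ‖e‖ₑ * eLpNorm φ 2 volume) hlim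
      (Or.inr (ENNReal.mul_ne_top enorm_ne_top hφm.eLpNorm_ne_top))
    rw [mul_zero] at h0
    refine tendsto_of_tendsto_of_tendsto_of_le_of_le tendsto_const_nhds h0
      (fun _ => zero_le) fun n => ?_
    have hDm : AEStronglyMeasurable (fun x => fderiv ℝ (w n) x e - G x e) volume :=
      (hdw n).aestronglyMeasurable.sub hGe.1
    have h1 : eLpNorm (fun x => fderiv ℝ (w n) x e - G x e) 2 volume ≤
        ‖e‖ₑ * eLpNorm (fun x => fderiv ℝ (w n) x - G x) 2 volume := by
      rw [← ofReal_norm]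
      refine eLpNorm_le_mul_eLpNorm_of_ae_le_mul (Eventually.of_forall fun x => ?_) 2
      rw [← sub_apply, mul_comm]
      exact ContinuousLinearMap.le_opNorm _ e
    calc _ = eLpNorm ((φ : Space d → ℝ) • fun x => fderiv ℝ (w n) x e - G x e) 1 volume := by
          congr 1
          ext x
          simp only [Pi.sub_apply, Pi.smul_apply', Pi.mul_apply, smul_eq_mul]
          ring
      _ ≤ eLpNorm φ 2 volume * eLpNorm (fun x => fderiv ℝ (w n) x e - G x e) 2 volume :=
          eLpNorm_smul_le_mul_eLpNorm (p := 2) (q := 2) (r := 1) hDm hφm.1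
      _ ≤ eLpNorm φ 2 volume * (‖e‖ₑ * eLpNorm (fun x => fderiv ℝ (w n) x - G x) 2 volume) := by
          gcongr
      _ = _ := by ring
  refine tendsto_nhds_unique hl ?_
  simp only [hparts]
  exact hr.neg

/-! ### The Poincaré inequality for functions of vanishing boundary mean -/

theorem lintegral_enorm_sq_eq {α F : Type*} [MeasurableSpace α] [NormedAddCommGroup F]
    (μ : Measure α) (f : α → F) : ∫⁻ x, ‖f x‖ₑ ^ 2 ∂μ = eLpNorm f 2 μ ^ 2 := by
  rw [eLpNorm_eq_lintegral_rpow_enorm_toReal (by norm_num) (by norm_num), ← ENNReal.rpow_natCast,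
    ← ENNReal.rpow_mul]
  simp

theorem eLpNorm_two_le_sub_add {α F : Type*} [MeasurableSpace α] [NormedAddCommGroup F]
    {μ : Measure α} {f g : α → F} (hf : AEStronglyMeasurable f μ) (hg : AEStronglyMeasurable g μ) :
    eLpNorm f 2 μ ≤ eLpNorm (fun x => f x - g x) 2 μ + eLpNorm g 2 μ := by
  have h := eLpNorm_two_add_le (hf.sub hg) hg
  rw [sub_add_cancel] at h
  exact h

/-- Fatou's lemma, once in each variable, handles the left side; the triangle inequality in `L²`
handles the gradients. -/
theorem lintegral_oscillation_le_of_tendsto {d : ℕ} {Ω : Set (Space d)} {ν₁ ν₂ : Measure (Space d)}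
    [SFinite ν₂] {C : ℝ≥0}
    (hC : ∀ w : Space d → ℝ, ContDiff ℝ 1 w →
      ∫⁻ x, ∫⁻ y, ‖w x - w y‖ₑ ^ 2 ∂ν₂ ∂ν₁ ≤ C * ∫⁻ z in Ω, ‖fderiv ℝ w z‖ₑ ^ 2)
    {v : Space d → ℝ} {w : ℕ → Space d → ℝ} {G : Space d → (Space d →L[ℝ] ℝ)}
    (hw : ∀ n, ContDiff ℝ 1 (w n)) (hu : ∀ x, Tendsto (fun n => w n x) atTop (𝓝 (v x)))
    (hG : MemLp G 2 volume)
    (hlim : Tendsto (fun n => eLpNorm (fun x => fderiv ℝ (w n) x - G x) 2 volume) atTop (𝓝 0)) :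
    ∫⁻ x, ∫⁻ y, ‖v x - v y‖ₑ ^ 2 ∂ν₂ ∂ν₁ ≤ C * ∫⁻ z in Ω, ‖G z‖ₑ ^ 2 := by
  have hmes : ∀ n, Measurable fun p : Space d × Space d => ‖w n p.1 - w n p.2‖ₑ ^ 2 := fun n => by
    have := (hw n).continuous
    exact (show Continuous fun p : Space d × Space d => ‖w n p.1 - w n p.2‖ₑ by
      fun_prop).measurable.pow_const 2
  have hconv : ∀ x y, liminf (fun n => ‖w n x - w n y‖ₑ ^ 2) atTop = ‖v x - v y‖ₑ ^ 2 :=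
    fun x y => Tendsto.liminf_eq
      (((ENNReal.continuous_pow 2).tendsto _).comp ((hu x).sub (hu y)).enorm)
  have hrhs : Tendsto (fun n => C * (eLpNorm (fun x => fderiv ℝ (w n) x - G x) 2 volume +
      eLpNorm G 2 (volume.restrict Ω)) ^ 2) atTop
      (𝓝 (C * (0 + eLpNorm G 2 (volume.restrict Ω)) ^ 2)) :=
    ENNReal.Tendsto.const_mul (((ENNReal.continuous_pow 2).tendsto _).comp
      (hlim.add tendsto_const_nhds)) (Or.inr ENNReal.coe_ne_top)
  calc ∫⁻ x, ∫⁻ y, ‖v x - v y‖ₑ ^ 2 ∂ν₂ ∂ν₁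
      = ∫⁻ x, ∫⁻ y, liminf (fun n => ‖w n x - w n y‖ₑ ^ 2) atTop ∂ν₂ ∂ν₁ := by simp only [hconv]
    _ ≤ ∫⁻ x, liminf (fun n => ∫⁻ y, ‖w n x - w n y‖ₑ ^ 2 ∂ν₂) atTop ∂ν₁ :=
        lintegral_mono fun x => lintegral_liminf_le fun n =>
          (hmes n).comp (by fun_prop : Measurable fun y => (x, y))
    _ ≤ liminf (fun n => ∫⁻ x, ∫⁻ y, ‖w n x - w n y‖ₑ ^ 2 ∂ν₂ ∂ν₁) atTop :=
        lintegral_liminf_le fun n => (hmes n).lintegral_prod_right'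
    _ ≤ liminf (fun n => C * (eLpNorm (fun x => fderiv ℝ (w n) x - G x) 2 volume +
          eLpNorm G 2 (volume.restrict Ω)) ^ 2) atTop := by
        refine liminf_le_liminf (Eventually.of_forall fun n => (hC (w n) (hw n)).trans ?_)
        rw [lintegral_enorm_sq_eq]
        gcongr
        refine (eLpNorm_two_le_sub_add
          ((hw n).continuous_fderiv (by norm_num)).aestronglyMeasurable hG.1.restrict).trans ?_
        gcongr
        exact Measure.restrict_le_self
    _ = _ := by rw [hrhs.liminf_eq, zero_add, lintegral_enorm_sq_eq]

theorem IsPolyhedralDomain.exists_lintegral_sq_le {d : ℕ} (hd : 1 ≤ d) {Ω : Set (Space d)}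
    (hΩ : IsPolyhedralDomain Ω) : ∃ C : ℝ≥0, ∀ (v : Space d → ℝ) (w : ℕ → Space d → ℝ)
      (G : Space d → (Space d →L[ℝ] ℝ)), (∀ n, ContDiff ℝ 1 (w n)) →
      TendstoUniformly w v atTop → MemLp G 2 volume →
      Tendsto (fun n => eLpNorm (fun x => fderiv ℝ (w n) x - G x) 2 volume) atTop (𝓝 0) →
      ∫ x, v x ∂(surfaceMeasure Ω) = 0 →
      ∫⁻ x in Ω, ‖v x‖ₑ ^ 2 ≤ C * ∫⁻ x in Ω, ‖G x‖ₑ ^ 2 := by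
  have hfinS := isFiniteMeasure_surfaceMeasure hΩ
  obtain ⟨C, hC⟩ := (hΩ.poincareRel hd).symm
  set m := surfaceMeasure Ω Set.univ with hm
  have hm0 : m ≠ 0 := by simpa [hm] using surfaceMeasure_ne_zero hd hΩ
  have hmt : m ≠ ⊤ := measure_ne_top _ _
  refine ⟨(m⁻¹ * C).toNNReal, fun v w G hw hu hG hlim hv => ?_⟩
  rw [ENNReal.coe_toNNReal (ENNReal.mul_ne_top (by simpa using hm0) ENNReal.coe_ne_top)]
  have hvc : Continuous v := hu.continuous (Frequently.of_forall fun n => (hw n).continuous)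
  have hosc := lintegral_oscillation_le_of_tendsto hC hw (fun x => hu.tendsto_at x) hG hlim
  have hvi : Integrable v (surfaceMeasure Ω) := by
    have hcomp : IsCompact (frontier Ω) :=
      Metric.isCompact_of_isClosed_isBounded isClosed_frontier (isBounded_frontier hΩ.isBounded)
    obtain ⟨M, hM⟩ := hcomp.exists_bound_of_continuousOn hvc.continuousOn
    refine (integrable_const M).mono' hvc.aestronglyMeasurable ?_
    rw [surfaceMeasure]
    filter_upwards [ae_restrict_mem isClosed_frontier.measurableSet] with x hx using hM x hx
  -- Zero boundary mean gives `m v(y) = ∫ (v(y) - v(x)) ds(x)`; Cauchy–Schwarz then costs one factor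
  -- `m`, which cancels.
  have hpt : ∀ y, m * ‖v y‖ₑ ^ 2 ≤ ∫⁻ x, ‖v y - v x‖ₑ ^ 2 ∂(surfaceMeasure Ω) := by
    intro y
    have h1 : ∫ x, (v y - v x) ∂(surfaceMeasure Ω) = m.toReal * v y := by
      rw [integral_sub (integrable_const _) hvi, hv, sub_zero, integral_const, smul_eq_mul]
      rfl
    have h2 : m * ‖v y‖ₑ ≤ ∫⁻ x, ‖v y - v x‖ₑ ∂(surfaceMeasure Ω) := by
      refine le_trans (le_of_eq ?_) (enorm_integral_le_lintegral_enorm _)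
      rw [h1, enorm_mul, Real.enorm_eq_ofReal ENNReal.toReal_nonneg, ENNReal.ofReal_toReal hmt]
    have hmes : Measurable fun x => ‖v y - v x‖ₑ :=
      (show Continuous fun x => ‖v y - v x‖ₑ by fun_prop).measurable
    have h3 := (pow_le_pow_left' h2 2).trans (sq_lintegral_le _ hmes.aemeasurable)
    rw [← ENNReal.mul_le_mul_iff_right hm0 hmt]
    exact le_trans (le_of_eq (by ring)) h3
  have h4 : m * ∫⁻ y in Ω, ‖v y‖ₑ ^ 2 ≤ C * ∫⁻ x in Ω, ‖G x‖ₑ ^ 2 := by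
    rw [← lintegral_const_mul _ (hvc.enorm.measurable.pow_const 2)]
    exact (lintegral_mono hpt).trans hosc
  calc _ = m⁻¹ * (m * ∫⁻ y in Ω, ‖v y‖ₑ ^ 2) := by
        rw [← mul_assoc, ENNReal.inv_mul_cancel hm0 hmt, one_mul]
    _ ≤ m⁻¹ * (C * ∫⁻ x in Ω, ‖G x‖ₑ ^ 2) := by gcongr
    _ = _ := by rw [mul_assoc]

theorem one_mem_multiplierSpace {d : ℕ} (p : ℕ) (𝒯 : Finset (Set (Space d))) :
    (fun _ => 1) ∈ multiplierSpace p 𝒯 := fun _ _ =>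
  ⟨1, by simp, by simp⟩

theorem integral_norm_sq_eq_toReal {α F : Type*} [MeasurableSpace α] [NormedAddCommGroup F]
    {μ : Measure α} {f : α → F} (hf : AEStronglyMeasurable f μ) :
    ∫ x, ‖f x‖ ^ 2 ∂μ = (∫⁻ x, ‖f x‖ₑ ^ 2 ∂μ).toReal := by
  rw [integral_eq_lintegral_of_nonneg_ae (Eventually.of_forall fun x => by positivity)
    (show AEStronglyMeasurable (fun x => ‖f x‖ ^ 2) μ from hf.norm.pow 2)]
  congr 2
  ext x
  rw [ENNReal.ofReal_pow (norm_nonneg _), ofReal_norm]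

end RBFMixed

/-! ### Norm equivalence on the constrained space -/

theorem lemma5p1 {d : ℕ} (hd : d = 2 ∨ d = 3)
    (Ω : Set (Space d)) (hΩ : IsPolyhedralDomain Ω)
    (τ : ℝ) (hτ : (d : ℝ) / 2 < τ)
    (Φ : Space d → ℝ) (hΦ : IsRadialBasisFunction τ Φ)
    (p : ℕ) (σ γ : ℝ) (hσ : 0 < σ) (hγ : 0 < γ) :
    ∃ k₀ : ℝ, 0 < k₀ ∧ ∃ C : ℝ, 0 < C ∧
      ∀ r : ℝ, 0 < r →
      ∀ X : Finset (Space d), IsQuasiUniformCenters Ω σ X →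
      ∀ 𝒯 : Finset (Set (Space d)), IsQuasiUniformPartition (frontier Ω) γ 𝒯 →
        meshSize 𝒯 ≤ k₀ →
      ∀ v ∈ constrainedSpace Ω Φ r X p 𝒯,
        MemH1 Ω v ∧
        h1Norm Ω v ≤ C * h1Seminorm Ω v ∧
        h1Norm Ω v ^ 2 ≤ C ^ 2 * formA Ω 0 v v := by
  have hd2 : 2 ≤ d := by omega
  have hΦ' := hΦ.isH1Limit hd2 hτ
  obtain ⟨C, hC⟩ := hΩ.exists_lintegral_sq_le (by omega)
  -- Any positive threshold serves, as 1 is a multiplier on every mesh. Adding the squared seminorm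
  -- to the Poincaré bound turns `C` into `C + 1`.
  refine ⟨1, one_pos, √(C + 1), by positivity, fun r hr X _ 𝒯 _ _ v hv => ?_⟩
  obtain ⟨w, G, hw, hu, hG, hlim⟩ := IsH1Limit.of_mem_rbfSpace hΦ' hr hv.1
  have hvc : Continuous v := hu.continuous (Filter.Frequently.of_forall fun n => (hw n).continuous)
  have hv0 : ∫ x, v x ∂(surfaceMeasure Ω) = 0 := by
    simpa [formB] using hv.2 _ (one_mem_multiplierSpace p 𝒯)
  have hest := hC v w G hw hu hG hlim hv0
  have hwg := isWeakGradient_of_tendsto Ω hw hu hG hlim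
  have hex : ∃ g, IsWeakGradient Ω v g := ⟨_, hwg⟩
  have hwg' : IsWeakGradient Ω v (weakGradient Ω v) := by
    rw [weakGradient, dif_pos hex]
    exact hex.choose_spec
  -- Existence excludes the default value 0, and uniqueness identifies the chosen gradient with the
  -- limit `G`.
  have hae := hwg'.ae_eq hΩ.isOpen hΩ.isBounded hwg
  have hGfin : ∫⁻ x in Ω, ‖G x‖ₑ ^ 2 ≠ ⊤ := by
    rw [lintegral_enorm_sq_eq]
    exact ENNReal.pow_ne_top (hG.restrict Ω).eLpNorm_ne_top
  have hvL : MemLp v 2 (volume.restrict Ω) := by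
    refine ⟨hvc.aestronglyMeasurable, ?_⟩
    have h1 : eLpNorm v 2 (volume.restrict Ω) ^ 2 < ⊤ := by
      rw [← lintegral_enorm_sq_eq]
      exact hest.trans_lt (ENNReal.mul_lt_top ENNReal.coe_lt_top hGfin.lt_top)
    exact (ENNReal.pow_lt_top_iff.1 h1).resolve_right two_ne_zero
  have hB : ∫ x in Ω, ‖weakGradient Ω v x‖ ^ 2 = (∫⁻ x in Ω, ‖G x‖ₑ ^ 2).toReal := by
    rw [← integral_norm_sq_eq_toReal hG.1.restrict]
    refine integral_congr_ae ?_
    filter_upwards [hae] with x hx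
    rw [hx, LinearIsometryEquiv.norm_map]
  have hA : ∫ x in Ω, v x ^ 2 = (∫⁻ x in Ω, ‖v x‖ₑ ^ 2).toReal := by
    rw [← integral_norm_sq_eq_toReal hvc.aestronglyMeasurable]
    simp
  have hAB : ∫ x in Ω, v x ^ 2 ≤ C * ∫ x in Ω, ‖weakGradient Ω v x‖ ^ 2 := by
    rw [hA, hB, ← ENNReal.coe_toReal C, ← ENNReal.toReal_mul]
    exact ENNReal.toReal_mono (ENNReal.mul_ne_top ENNReal.coe_ne_top hGfin) hest
  have hB0 : 0 ≤ ∫ x in Ω, ‖weakGradient Ω v x‖ ^ 2 := integral_nonneg fun x => by positivity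
  have hA0 : 0 ≤ ∫ x in Ω, v x ^ 2 := integral_nonneg fun x => by positivity
  refine ⟨⟨hvL, hex⟩, ?_, ?_⟩
  · rw [h1Norm, h1Seminorm, ← Real.sqrt_mul (by positivity)]
    exact Real.sqrt_le_sqrt (by linarith)
  · have hform : formA Ω 0 v v = ∫ x in Ω, ‖weakGradient Ω v x‖ ^ 2 := by
      simp [formA]
    rw [hform, h1Norm, Real.sq_sqrt (by positivity), Real.sq_sqrt (by positivity)]
    linarith
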